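/- **Conventions.** A planar map is a finite connected graph (loops and multiple edges allowed) with at least one edge, drawn on the oriented sphere without edge crossings and considered up to orientation-preserving homeomorphism. The degree of a vertex or face is its number of incident corners; a tree is a planar map with a single face. A *suitably labeled map* (resp. *well-labeled map*) is a planar map whose vertices carry integer labels such that the labels of adjacent vertices differ by exactly $1$ (resp. at most $1$). A *local min* is a vertex every neighbor of which has greater label. A *mobile* is a bipartite planar map in which the vertices of one class of the bipartition carry integer labels, those of the other class being unlabeled, such that whenever two neighbors of an unlabeled vertex with labels $\ell,\ell'$ appear consecutively in clockwise order around it, $\ell'\ge \ell-1$. Labeled maps and mobiles are considered up to isomorphisms preserving the orientation and the labels. **Construction.** Given a suitably labeled map, add one unlabeled vertex inside each face; for each edge of the map, with endpoints $x,y$ labeled $\ell-1,\ell$, connect $y$ to the unlabeled vertex of the face on the left of this edge as seen from $x$; finally erase the original edges and the local min. **Theorem.** This construction is a bijection between suitably labeled maps and mobiles. For each suitably labeled map and its mobile, the construction induces one-to-one correspondences between - the local min of the map and the faces of the mobile (the local min $x$ corresponds to the face of the mobile in which it lies); - the vertices of the map that are not local min and the labeled vertices of the mobile, with the same labels; - the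 faces of degree $2k$ of the map and the unlabeled vertices of degree $k$ of the mobile (all the faces of the map having even degree); - the edges of the map with endpoints labeled $\ell/\ell-1$ and the corners of the mobile at vertices labeled $\ell$. Moreover it specializes as follows. - Quadrangulations (Miermont/Ambjørn–Budd). Suitably labeled quadrangulations are in bijection with well-labeled maps: the quadrangulation $M$ corresponds to the well-labeled map $W$ if and only if the mobile of $M$ is obtained from $W$ by adding an unlabeled vertex in the middle of each edge. - Geodesic labelings (Bouttier–Di Francesco–Guitter). A suitably labeled map has a unique local min if and only if its mobile is a tree. A vertex $m$ is the unique local min if and only if the label of each vertex $v$ is the label of $m$ plus the graph distance from $m$ to $v$; and on each bipartite planar map with a distinguished vertex $m$, the graph distance to $m$ is a suitable labeling. - Intersection of the two (Cori–Vauquelin–Schaeffer). A suitably labeled quadrangulation has a unique local min if and only if the corresponding well-labeled map is a tree. -/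

import Mathlib

/-- A finite combinatorial map: a finite graph embedded in an oriented surface, up to
orientation-preserving homeomorphism. A dart is an oriented edge; `rot d` is the next dart
counterclockwise around the origin of `d`, and `rev d` is the same edge with the opposite
orientation. No connectedness or planarity is required here. -/
structure CombMap where
  Dart : Type
  finite_dart : Finite Dart
  rot : Equiv.Perm Dart
  rev : Equiv.Perm Dart
  rev_rev : ∀ d, rev (rev d) = d
  rev_ne : ∀ d, rev d ≠ d

namespace CombMap

/-- Turning around a face: `faceRot d` is the dart that follows `d` on the contour of the face on
the left of `d`. At the end of `d` it is the next one clockwise after `rev d`. -/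
def faceRot (C : CombMap) : Equiv.Perm C.Dart := C.rot⁻¹ * C.rev

/-- Vertices are the cycles of `rot`. -/
def Vertex (C : CombMap) : Type := Quotient (Equiv.Perm.SameCycle.setoid C.rot)

/-- Edges are the cycles `{d, rev d}` of `rev`. -/
def Edge (C : CombMap) : Type := Quotient (Equiv.Perm.SameCycle.setoid C.rev)

/-- Faces are the cycles of `faceRot`. -/
def Face (C : CombMap) : Type := Quotient (Equiv.Perm.SameCycle.setoid C.faceRot)

/-- The origin of a dart. The endpoint of `d` is `origin (rev d)`. -/
def origin (C : CombMap) (d : C.Dart) : C.Vertex := Quotient.mk _ d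

/-- The edge that carries a dart. -/
def edge (C : CombMap) (d : C.Dart) : C.Edge := Quotient.mk _ d

/-- The face on the left of a dart. -/
def leftFace (C : CombMap) (d : C.Dart) : C.Face := Quotient.mk _ d

/-- Corners are in one-to-one correspondence with darts: the corner `c` is the angular sector
at the origin of `c` between the dart `c` and the next dart `rot c` counterclockwise. It is
incident to the vertex `origin c` and to the face `leftFace c`. -/
abbrev Corner (C : CombMap) : Type := C.Dart

/-- The degree of a vertex is its number of incident corners. -/
noncomputable def vertexDegree (C : CombMap) (v : C.Vertex) : ℕ :=
  Nat.card {c : C.Corner // C.origin c = v}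

/-- The degree of a face is its number of incident corners. -/
noncomputable def faceDegree (C : CombMap) (f : C.Face) : ℕ :=
  Nat.card {c : C.Corner // C.leftFace c = f}

/-- Planar maps with at least one edge: connected (any dart can be reached from any other one by
turning around vertices and along edges) and of genus `0`, i.e. `V + F = E + 2`. -/
def IsPlanar (C : CombMap) : Prop :=
  Nonempty C.Dart ∧
  MulAction.IsPretransitive (Subgroup.closure {C.rot, C.rev}) C.Dart ∧
  Nat.card C.Vertex + Nat.card C.Face = Nat.card C.Edge + 2

/-- A map is bipartite if its vertices can be partitioned in two subsets so that no edge has its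
two endpoints in the same subset. -/
def IsBipartite (C : CombMap) : Prop :=
  ∃ s : Set C.Vertex, ∀ d, C.origin d ∈ s ↔ C.origin (C.rev d) ∉ s

/-- The simple graph underlying a map. -/
def graph (C : CombMap) : SimpleGraph C.Vertex :=
  SimpleGraph.fromRel fun v w => ∃ d, C.origin d = v ∧ C.origin (C.rev d) = w

end CombMap

/-- A combinatorial map whose vertices carry labels in `L`. -/
structure LabeledMap (L : Type) extends CombMap where
  label : toCombMap.Vertex → L

namespace LabeledMap

/-- Isomorphism of labeled maps (orientation and labels are preserved). -/
def Iso {L : Type} (M N : LabeledMap L) : Prop :=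
  ∃ e : M.Dart ≃ N.Dart,
    (∀ d, e (M.rot d) = N.rot (e d)) ∧
    (∀ d, e (M.rev d) = N.rev (e d)) ∧
    (∀ d, N.label (N.origin (e d)) = M.label (M.origin d))

theorem Iso.refl {L : Type} (M : LabeledMap L) : M.Iso M :=
  ⟨Equiv.refl _, fun _ => rfl, fun _ => rfl, fun _ => rfl⟩

theorem Iso.symm {L : Type} {M N : LabeledMap L} (h : M.Iso N) : N.Iso M := by
  obtain ⟨e, h1, h2, h3⟩ := h
  refine ⟨e.symm, fun d => ?_, fun d => ?_, fun d => ?_⟩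
  · rw [Equiv.symm_apply_eq, h1, Equiv.apply_symm_apply]
  · rw [Equiv.symm_apply_eq, h2, Equiv.apply_symm_apply]
  · rw [← h3, Equiv.apply_symm_apply]

theorem Iso.trans {L : Type} {M N P : LabeledMap L} (h : M.Iso N) (k : N.Iso P) : M.Iso P := by
  obtain ⟨e, h1, h2, h3⟩ := h
  obtain ⟨f, k1, k2, k3⟩ := k
  exact ⟨e.trans f, fun d => by simp [h1, k1], fun d => by simp [h2, k2],
    fun d => by simp [h3, k3]⟩

/-- The isomorphism relation on the labeled maps that satisfy `P`. -/
def isoSetoid {L : Type} (P : LabeledMap L → Prop) : Setoid {M : LabeledMap L // P M} where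
  r M N := M.1.Iso N.1
  iseqv := ⟨fun M => Iso.refl M.1, fun h => h.symm, fun h k => h.trans k⟩

/-- The isomorphism classes of labeled maps that satisfy `P`. -/
abbrev IsoClass {L : Type} (P : LabeledMap L → Prop) : Type 1 := Quotient (isoSetoid P)

/-- The isomorphism class of a labeled map that satisfies `P`. -/
def isoClass {L : Type} (P : LabeledMap L → Prop) (M : LabeledMap L) (h : P M) : IsoClass P :=
  Quotient.mk _ ⟨M, h⟩

/-- Suitably labeled maps: planar maps with integer labels on the vertices, the labels of adjacent
vertices differing by exactly `1`. -/
def IsSuitablyLabeled (M : LabeledMap ℤ) : Prop :=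
  M.IsPlanar ∧ ∀ d, |M.label (M.origin (M.rev d)) - M.label (M.origin d)| = 1

/-- Well-labeled maps: planar maps with integer labels on the vertices, the labels of adjacent
vertices differing by at most `1`. -/
def IsWellLabeled (M : LabeledMap ℤ) : Prop :=
  M.IsPlanar ∧ ∀ d, |M.label (M.origin (M.rev d)) - M.label (M.origin d)| ≤ 1

/-- The map `C` with each vertex labeled by its graph distance to the vertex `m`. -/
noncomputable def geodesic (C : CombMap) (m : C.Vertex) : LabeledMap ℤ where
  toCombMap := C
  label v := (C.graph.dist m v : ℤ)

/-- A quadrangulation: all faces have degree four. -/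
def IsQuadrangulation {L : Type} (M : LabeledMap L) : Prop := ∀ f, M.faceDegree f = 4

/-- A local min is a vertex every neighbor of which has greater label. -/
def IsLocalMin (M : LabeledMap ℤ) (v : M.Vertex) : Prop :=
  ∀ d, M.origin d = v → M.label v < M.label (M.origin (M.rev d))

/-- A dart going from a smaller to a larger label. -/
def IsUp (M : LabeledMap ℤ) (d : M.Dart) : Prop :=
  M.label (M.origin d) < M.label (M.origin (M.rev d))

/-- A dart going from a larger to a smaller label. -/
def IsDown (M : LabeledMap ℤ) (d : M.Dart) : Prop :=
  M.label (M.origin (M.rev d)) < M.label (M.origin d)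

/-- Mobiles: bipartite planar maps, one class of the bipartition consisting of the labeled
vertices (label `some ℓ`) and the other one of the unlabeled vertices (label `none`), such that
if `ℓ, ℓ'` are the labels of two neighbors of an unlabeled vertex that are consecutive in
clockwise order around it, then `ℓ' ≥ ℓ - 1`. -/
def IsMobile (B : LabeledMap (Option ℤ)) : Prop :=
  B.IsPlanar ∧
  (∀ d, B.label (B.origin d) = none ↔ B.label (B.origin (B.rev d)) ≠ none) ∧
  (∀ d, B.label (B.origin d) = none → ∀ l l' : ℤ,
    B.label (B.origin (B.rev d)) = some l →
    B.label (B.origin (B.rev (B.rot⁻¹ d))) = some l' → l' ≥ l - 1)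

end LabeledMap

section FirstReturn

set_option linter.unusedSectionVars false

variable {α : Type} [Finite α]

open Classical in
/-- First return to `P` under `p`: an element of `P` is sent to the first of its iterates
`p x, p (p x), …` that lies in `P`. Elements outside `P` are fixed. -/
noncomputable def firstReturnFun (p : Equiv.Perm α) (P : α → Prop) (x : α) : α :=
  if P x then (p ^ sInf {k : ℕ | 0 < k ∧ P ((p ^ k) x)}) x else x

theorem firstReturn_spec (p : Equiv.Perm α) {P : α → Prop} {x : α} (hx : P x) :
    0 < sInf {k : ℕ | 0 < k ∧ P ((p ^ k) x)} ∧
      P ((p ^ sInf {k : ℕ | 0 < k ∧ P ((p ^ k) x)}) x) := by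
  have hne : {k : ℕ | 0 < k ∧ P ((p ^ k) x)}.Nonempty :=
    ⟨orderOf p, orderOf_pos p, by simpa [pow_orderOf_eq_one] using hx⟩
  exact Nat.sInf_mem hne

theorem firstReturnFun_mem (p : Equiv.Perm α) {P : α → Prop} {x : α} (hx : P x) :
    P (firstReturnFun p P x) := by
  rw [firstReturnFun, if_pos hx]
  exact (firstReturn_spec p hx).2

theorem firstReturnFun_of_not (p : Equiv.Perm α) {P : α → Prop} {x : α} (hx : ¬ P x) :
    firstReturnFun p P x = x := by
  rw [firstReturnFun, if_neg hx]

theorem firstReturnFun_sameCycle (p : Equiv.Perm α) (P : α → Prop) (x : α) :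
    p.SameCycle x (firstReturnFun p P x) := by
  unfold firstReturnFun
  split_ifs
  · exact ⟨((sInf {k : ℕ | 0 < k ∧ P ((p ^ k) x)} : ℕ) : ℤ), by rw [zpow_natCast]⟩
  · exact Equiv.Perm.SameCycle.refl _ _

theorem firstReturn_le {p : Equiv.Perm α} {P : α → Prop} {x y : α} (hx : P x) {j k : ℕ}
    (hj : 0 < j) (hk : k = sInf {k : ℕ | 0 < k ∧ P ((p ^ k) y)}) (hjk : j ≤ k)
    (h : (p ^ j) x = (p ^ k) y) : x = y := by
  have h1 : x = (p ^ (k - j)) y := by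
    apply (p ^ j).injective
    rw [h, ← Equiv.Perm.mul_apply, ← pow_add, Nat.add_sub_cancel' hjk]
  rcases Nat.eq_zero_or_pos (k - j) with h0 | h0
  · simpa [h0] using h1
  · have hmem : k - j ∈ {k : ℕ | 0 < k ∧ P ((p ^ k) y)} := ⟨h0, h1 ▸ hx⟩
    have hle := Nat.sInf_le hmem
    omega

theorem firstReturnFun_injective (p : Equiv.Perm α) (P : α → Prop) :
    Function.Injective (firstReturnFun p P) := by
  intro x y h
  by_cases hx : P x <;> by_cases hy : P y
  · rw [firstReturnFun, firstReturnFun, if_pos hx, if_pos hy] at h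
    rcases le_total (sInf {k : ℕ | 0 < k ∧ P ((p ^ k) x)})
      (sInf {k : ℕ | 0 < k ∧ P ((p ^ k) y)}) with hl | hl
    · exact firstReturn_le hx (firstReturn_spec p hx).1 rfl hl h
    · exact (firstReturn_le hy (firstReturn_spec p hy).1 rfl hl h.symm).symm
  · rw [firstReturnFun_of_not p hy] at h
    exact absurd (h ▸ firstReturnFun_mem p hx) hy
  · rw [firstReturnFun_of_not p hx] at h
    exact absurd (h ▸ firstReturnFun_mem p hy) hx
  · rwa [firstReturnFun_of_not p hx, firstReturnFun_of_not p hy] at h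

/-- `firstReturnFun` as a permutation. -/
noncomputable def firstReturn (p : Equiv.Perm α) (P : α → Prop) : Equiv.Perm α :=
  Equiv.ofBijective (firstReturnFun p P)
    (Finite.injective_iff_bijective.mp (firstReturnFun_injective p P))

theorem firstReturn_apply (p : Equiv.Perm α) (P : α → Prop) (x : α) :
    firstReturn p P x = firstReturnFun p P x := rfl

end FirstReturn

theorem Equiv.Perm.SameCycle.invariant {α β : Type} {p : Equiv.Perm α} {f : α → β}
    (hf : ∀ x, f (p x) = f x) {x y : α} (h : p.SameCycle x y) : f x = f y := by
  obtain ⟨n, rfl⟩ := h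
  induction n using Int.induction_on with
  | zero => simp
  | succ i ih => rw [add_comm, zpow_add, zpow_one, Equiv.Perm.mul_apply, hf]; exact ih
  | pred i ih =>
    rw [ih, ← hf ((p ^ (-(i : ℤ) - 1)) x), ← Equiv.Perm.mul_apply, ← zpow_one_add]
    congr 3
    ring

namespace LabeledMap

/-- The rotation system of the mobile of `M`, described in `mobileOf`. -/
noncomputable def mobileRot (M : LabeledMap ℤ) : Equiv.Perm M.Dart :=
  haveI := M.finite_dart
  firstReturn M.rot M.IsDown * firstReturn M.faceRot M.IsUp

theorem mobileRot_same_orbit (M : LabeledMap ℤ) (d : M.Dart) :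
    (M.IsDown (M.mobileRot d) ↔ M.IsDown d) ∧
      (M.IsDown d → M.origin (M.mobileRot d) = M.origin d) := by
  have := M.finite_dart
  have key : M.mobileRot d
      = firstReturnFun M.rot M.IsDown (firstReturnFun M.faceRot M.IsUp d) := rfl
  by_cases hd : M.IsDown d
  · have hu : ¬ M.IsUp d := fun hu => lt_asymm hu hd
    rw [firstReturnFun_of_not _ hu] at key
    rw [key]
    exact ⟨iff_of_true (firstReturnFun_mem _ hd) hd,
      fun _ => Quotient.sound (firstReturnFun_sameCycle M.rot M.IsDown d).symm⟩
  · have h1 : ¬ M.IsDown (firstReturnFun M.faceRot M.IsUp d) := by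
      by_cases hu : M.IsUp d
      · intro h
        have hu' : M.IsUp (firstReturnFun M.faceRot M.IsUp d) := firstReturnFun_mem M.faceRot hu
        exact lt_asymm hu' h
      · rwa [firstReturnFun_of_not _ hu]
    rw [firstReturnFun_of_not _ h1] at key
    rw [key]
    exact ⟨iff_of_false h1 hd, fun h => absurd h hd⟩

open Classical in
/-- The label in the mobile of the origin of a dart: the original label if the origin is a
vertex of `M`, and `none` if it is the unlabeled vertex added in a face. -/
noncomputable def mobileDartLabel (M : LabeledMap ℤ) (d : M.Dart) : Option ℤ :=
  if M.IsDown d then some (M.label (M.origin d)) else none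

theorem mobileDartLabel_mobileRot (M : LabeledMap ℤ) (d : M.Dart) :
    M.mobileDartLabel (M.mobileRot d) = M.mobileDartLabel d := by
  obtain ⟨h1, h2⟩ := M.mobileRot_same_orbit d
  by_cases hd : M.IsDown d
  · rw [mobileDartLabel, mobileDartLabel, if_pos hd, if_pos (h1.2 hd), h2 hd]
  · rw [mobileDartLabel, mobileDartLabel, if_neg hd, if_neg (fun h => hd (h1.1 h))]

/-- The mobile construction: add an unlabeled vertex `u_f` in each face `f` of `M`; for each edge
`x — y` of `M` with `label x < label y`, draw in the face `f` on the left of the dart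
`x → y` an edge between `y` and `u_f`; erase the edges of `M` and the local min.

The mobile edge drawn for an edge of `M` uses the same two darts: the up dart `d : x → y` stands
for the mobile dart `u_f → y`, and the down dart `rev d : y → x` for the mobile dart `y → u_f`.
Since at `y` the mobile dart `rev d` is next to the edge `rev d` of `M`, the mobile darts at `y`
are the down darts at `y` in their order around `y`. Since `u_f → y` is drawn in the corner of
`f` at the end of `d`, the mobile darts at `u_f` are the up darts with `f` on their left, in their
order along the contour of `f`. The mobile corner `rev d` at `y` contains the edge `rev d`. -/
noncomputable def mobileOf (M : LabeledMap ℤ) : LabeledMap (Option ℤ) where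
  Dart := M.Dart
  finite_dart := M.finite_dart
  rot := M.mobileRot
  rev := M.rev
  rev_rev := M.rev_rev
  rev_ne := M.rev_ne
  label := Quotient.lift M.mobileDartLabel
    (fun _ _ h => Equiv.Perm.SameCycle.invariant M.mobileDartLabel_mobileRot h)

/-- The mobile dart carried by a dart of `M`, see `mobileOf`. -/
def toMobile (M : LabeledMap ℤ) (d : M.Dart) : M.mobileOf.Dart := d

/-- The map obtained by adding an unlabeled vertex in the middle of each edge. The dart `inl d`
goes from the origin of `d` to the middle of `d`, and the dart `inr d` is its reverse. -/
def subdivide (W : LabeledMap ℤ) : LabeledMap (Option ℤ) where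
  Dart := W.Dart ⊕ W.Dart
  finite_dart := haveI := W.finite_dart; inferInstance
  rot := Equiv.sumCongr W.rot W.rev
  rev := Equiv.sumComm W.Dart W.Dart
  rev_rev := by rintro (d | d) <;> rfl
  rev_ne := by rintro (d | d) h <;> cases h
  label := Quotient.lift
    (Sum.elim (fun d => some (W.label (W.origin d))) (fun _ => none))
    (fun _ _ h => Equiv.Perm.SameCycle.invariant
      (by
        rintro (d | d)
        · exact congrArg (fun v => some (W.label v))
            (Quotient.sound (⟨-1, by simp⟩ : W.rot.SameCycle (W.rot d) d))
        · rfl) h)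

end LabeledMap

/-! A map and its mobile have the same darts and the same `rev`; a down dart is both an edge leaving
its upper endpoint and the mobile corner containing that edge. In a mobile, `turn` leads from a
labeled corner to the next labeled corner on the contour of the same face, and the mobile condition
says that the label falls by at most one per step. This forces the inverse construction: join each
labeled corner to its successor, the first later corner of smaller label, whose label is then
exactly one less. Corners of minimal label in a face have no successor; they are joined to a new
vertex inside the face, the local min.

`ChordAt` expresses this without naming the successor, by the dart that follows `rev c` around the
far end of the edge drawn from `c`. If `turn c` is lower, the edge is the last one in the corner
`turn c`, and the mobile dart `rot (turn c)` follows. Otherwise the next corner of label at most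
that of `c` has the same label and the same successor, and its edge follows. For minimal corners the
second case always applies, so their edges close up into one vertex without down darts. The rule
gives the rotation on up darts, and the mobile gives its first returns to down darts; such data
determine a permutation (`perm_eq_of_hit`) and can be realized (`exists_perm_of_hit`).

Injectivity rests on `chordAt_of_rotation`: the edges of every suitably labeled map obey the rule
for its mobile. Surjectivity rests on `MobileRotation.hit_faceRot`: a rotation obeying the rule
gives back the mobile. Both trace a face contour between consecutive up darts, where each down step
passes from a corner to its successor.

Planarity plays no role so far. Local min, other vertices and faces of the map match faces, labeled
vertices and unlabeled vertices of the mobile, so `V + F` and `E` agree and the genus is preserved.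
A quadrangulation is the case where all unlabeled vertices have degree two and can be smoothed out;
a unique local min means a mobile with one face, and descending paths show that the labeling is then
geodesic. -/

/-! ### First hits of a predicate under a permutation -/

/-- `Hit p P x y` says that `y` is the first of the iterates `p x, p (p x), …` that satisfies
`P`. -/
inductive Hit {α : Type} (p : Equiv.Perm α) (P : α → Prop) : α → α → Prop
  | now {x : α} : P (p x) → Hit p P x (p x)
  | later {x y : α} : ¬ P (p x) → Hit p P (p x) y → Hit p P x y

namespace Hit

variable {α : Type} {p : Equiv.Perm α} {P : α → Prop}

theorem now_of_eq {x y : α} (h : p x = y) (hy : P y) : Hit p P x y := by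
  subst h; exact .now hy

theorem mem {x y : α} (h : Hit p P x y) : P y := by
  induction h with
  | now h => exact h
  | later _ _ ih => exact ih

theorem now_or_later {x y : α} (h : Hit p P x y) : p x = y ∨ ¬ P (p x) ∧ Hit p P (p x) y := by
  cases h with
  | now h => exact Or.inl rfl
  | later h k => exact Or.inr ⟨h, k⟩

theorem unique {x y z : α} (h : Hit p P x y) (k : Hit p P x z) : y = z := by
  induction h with
  | now h =>
    cases k with
    | now _ => rfl
    | later h' _ => exact absurd h h'
  | later h _ ih =>
    cases k with
    | now h' => exact absurd h' h
    | later _ k => exact ih k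

theorem exists_pow {x y : α} (h : Hit p P x y) :
    ∃ k : ℕ, 0 < k ∧ (p ^ k) x = y ∧ ∀ j, 0 < j → j < k → ¬ P ((p ^ j) x) := by
  induction h with
  | now h => exact ⟨1, one_pos, by simp, fun j h1 h2 => by omega⟩
  | @later x y h _ ih =>
    obtain ⟨k, _, h2, h3⟩ := ih
    refine ⟨k + 1, by omega, by rw [pow_succ, Equiv.Perm.mul_apply, h2], fun j h4 h5 => ?_⟩
    obtain ⟨j, rfl⟩ : ∃ i, j = i + 1 := ⟨j - 1, by omega⟩
    rcases Nat.eq_zero_or_pos j with rfl | hj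
    · simpa using h
    · rw [pow_succ, Equiv.Perm.mul_apply]
      exact h3 j hj (by omega)

theorem sameCycle {x y : α} (h : Hit p P x y) : p.SameCycle x y := by
  obtain ⟨k, _, hk, _⟩ := h.exists_pow
  exact ⟨k, by rwa [zpow_natCast]⟩

theorem of_pow {x : α} (k : ℕ) (hk : 0 < k) (h : P ((p ^ k) x)) : ∃ y, Hit p P x y := by
  induction k generalizing x with
  | zero => omega
  | succ k ih =>
    by_cases h1 : P (p x)
    · exact ⟨_, .now h1⟩
    · rcases Nat.eq_zero_or_pos k with rfl | h0
      · exact absurd (by simpa using h) h1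
      · rw [pow_succ, Equiv.Perm.mul_apply] at h
        obtain ⟨y, hy⟩ := ih h0 h
        exact ⟨y, .later h1 hy⟩

theorem exists_of_mem [Finite α] {x : α} (h : P x) : ∃ y, Hit p P x y :=
  of_pow (orderOf p) (orderOf_pos p) (by simpa [pow_orderOf_eq_one] using h)

/-- The elements skipped on the way to `y` fail `Q`, hence also the stronger `P`. -/
theorem trans_of_le {Q : α → Prop} {x y z : α} (h : Hit p Q x y) (hPQ : ∀ w, P w → Q w)
    (hy : ¬ P y) (k : Hit p P y z) : Hit p P x z := by
  induction h with
  | now h => exact .later hy k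
  | later h _ ih => exact .later (fun h' => h (hPQ _ h')) (ih hy k)

/-- After the first step only elements outside `P` are moved, and there `q` and `p` agree. -/
theorem transfer {q : Equiv.Perm α} {x x' y : α} (h : Hit p P x y) (hx : q x' = p x)
    (hq : ∀ z, ¬ P z → q z = p z) : Hit q P x' y := by
  induction h generalizing x' with
  | now h => exact now_of_eq hx h
  | later h _ ih => exact .later (hx ▸ h) (ih (by rw [hx]; exact hq _ h))

theorem map {β : Type} {q : Equiv.Perm β} {Q : β → Prop} (e : α → β)
    (he : ∀ x, e (p x) = q (e x)) (hP : ∀ x, Q (e x) ↔ P x) {x y : α} (h : Hit p P x y) :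
    Hit q Q (e x) (e y) := by
  induction h with
  | now h => exact now_of_eq (he _).symm ((hP _).2 h)
  | later h _ ih =>
    refine .later ?_ (he _ ▸ ih)
    rw [← he, hP]
    exact h

theorem congr_pred {Q : α → Prop} (hPQ : ∀ x, P x ↔ Q x) {x y : α} (h : Hit p P x y) :
    Hit p Q x y :=
  h.map id (fun _ => rfl) (fun x => (hPQ x).symm)

theorem last_step {x y : α} (h : Hit p P x y) : p x = y ∨ ∃ u, ¬ P u ∧ p u = y := by
  induction h with
  | now h => exact Or.inl rfl
  | later h _ ih =>
    rcases ih with ih | ih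
    · exact Or.inr ⟨_, h, ih⟩
    · exact Or.inr ih

end Hit

/-- A function that is constant along the steps starting outside `P` and along the first returns
to `P` is invariant. -/
theorem invariant_of_hit {α β : Type} {p : Equiv.Perm α} {P : α → Prop} {q : α → α} {f : α → β}
    (h : ∀ x, P x → Hit p P x (q x)) (h1 : ∀ x, ¬ P x → f (p x) = f x)
    (h2 : ∀ x, P x → f (q x) = f x) (x : α) : f (p x) = f x := by
  by_cases hx : P x
  · have key : ∀ x y, Hit p P x y → f (p x) = f y := by
      intro x y hxy
      induction hxy with
      | now _ => rfl
      | later h _ ih => rw [← ih, h1 _ h]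
    rw [key x _ (h x hx), h2 x hx]
  · exact h1 x hx

/-- A permutation is determined by its values outside `P` and its first returns to `P`. -/
theorem perm_eq_of_hit {α : Type} {P : α → Prop} {p p' q : Equiv.Perm α}
    (h : ∀ x, ¬ P x → p x = p' x) (h1 : ∀ x, P x → Hit p P x (q x))
    (h2 : ∀ x, P x → Hit p' P x (q x)) : p = p' := by
  ext x
  by_cases hx : P x
  · obtain ⟨z, hz⟩ := p'.surjective (p x)
    by_cases hPz : P z
    · have h3 := (h1 x hx).transfer hz fun z hz => (h z hz).symm
      have h4 := q.injective (h3.unique (h2 z hPz))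
      rw [← hz, ← h4]
    · exact absurd (p.injective (hz.symm.trans (h z hPz).symm) ▸ hx) hPz
  · exact h x hx

/-! ### First returns on a finite set -/

section FirstReturn

variable {α : Type} [Finite α] {p : Equiv.Perm α} {P : α → Prop}

theorem firstReturn_eq_of_hit {x y : α} (hx : P x) (h : Hit p P x y) : firstReturn p P x = y := by
  obtain ⟨k, h1, h2, h3⟩ := h.exists_pow
  obtain ⟨h4, h5⟩ := firstReturn_spec p hx
  have hk : sInf {k : ℕ | 0 < k ∧ P ((p ^ k) x)} = k := by
    refine le_antisymm (Nat.sInf_le ⟨h1, h2 ▸ h.mem⟩) ?_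
    by_contra hlt
    exact h3 _ h4 (not_le.1 hlt) h5
  rw [firstReturn_apply, firstReturnFun, if_pos hx, hk, h2]

theorem hit_firstReturn {x : α} (hx : P x) : Hit p P x (firstReturn p P x) := by
  obtain ⟨y, hy⟩ := Hit.exists_of_mem (p := p) hx
  rwa [firstReturn_eq_of_hit hx hy]

theorem firstReturn_of_not {x : α} (hx : ¬ P x) : firstReturn p P x = x :=
  firstReturnFun_of_not p hx

theorem firstReturn_of_invariant (h : ∀ x, P x → P (p x)) {x : α} (hx : P x) :
    firstReturn p P x = p x :=
  firstReturn_eq_of_hit hx (.now (h x hx))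

theorem Hit.injective {x y z : α} (hx : P x) (hy : P y) (h : Hit p P x z) (k : Hit p P y z) :
    x = y :=
  (firstReturn p P).injective
    ((firstReturn_eq_of_hit hx h).trans (firstReturn_eq_of_hit hy k).symm)

/-- Passing to the first return shortens the cycles without merging or splitting them; this
identifies vertices and faces of the map with vertices of the mobile. -/
theorem sameCycle_iff_of_hit {q : Equiv.Perm α} (h : ∀ x, P x → Hit p P x (q x)) {x y : α}
    (hx : P x) (hy : P y) : q.SameCycle x y ↔ p.SameCycle x y := by
  constructor
  · rintro hxy
    obtain ⟨n, rfl⟩ := hxy.exists_nat_pow_eq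
    clear hxy hy
    induction n with
    | zero => exact Equiv.Perm.SameCycle.refl _ _
    | succ n ih =>
      have hn : P ((q ^ n) x) := by
        clear ih
        induction n with
        | zero => exact hx
        | succ n ih => rw [pow_succ', Equiv.Perm.mul_apply]; exact (h _ ih).mem
      rw [pow_succ', Equiv.Perm.mul_apply]
      exact ih.trans (h _ hn).sameCycle
  · intro hxy
    obtain ⟨n, hn⟩ := hxy.exists_nat_pow_eq
    clear hxy
    induction n using Nat.strong_induction_on generalizing x with
    | _ n ih =>
      rcases Nat.eq_zero_or_pos n with rfl | h0
      · exact ⟨0, by simpa using hn⟩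
      · obtain ⟨k, h1, h2, h3⟩ := (h x hx).exists_pow
        have hk : k ≤ n := by
          by_contra hlt
          exact h3 n h0 (not_le.1 hlt) (hn ▸ hy)
        refine (Equiv.Perm.sameCycle_apply_right.2 (Equiv.Perm.SameCycle.refl _ _)).trans
          (ih (n - k) (by omega) (h x hx).mem ?_)
        rw [← h2, ← Equiv.Perm.mul_apply, ← pow_add, Nat.sub_add_cancel hk, hn]

/-- A partial injection defined outside `P` extends to a permutation with prescribed first
returns to `P`. -/
theorem exists_perm_of_hit {g : α → α} (hg : Set.InjOn g {x | ¬ P x}) {q : Equiv.Perm α}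
    (hq : ∀ x, P x → P (q x)) :
    ∃ r : Equiv.Perm α, (∀ x, ¬ P x → r x = g x) ∧ ∀ x, P x → Hit r P x (q x) := by
  classical
  have := Fintype.ofFinite α
  obtain ⟨e, he⟩ := Set.MapsTo.exists_equiv_extend_of_card_eq (t := (Finset.univ : Finset α))
    (by simp) (fun x _ => by simp : Set.MapsTo g {x | ¬ P x} _) hg
  obtain ⟨s, hs⟩ : ∃ s : Equiv.Perm α, ∀ x, ¬ P x → s x = g x :=
    ⟨e.trans (Equiv.subtypeUnivEquiv (by simp)), fun x hx => he x hx⟩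
  -- Both first returns fix the complement of `P`, so the product equals `s` there. An `x` in `P`
  -- goes to `s z`, where `z` is the element whose first return under `s` is `q x`.
  refine ⟨s * (firstReturn s P)⁻¹ * firstReturn q P, ?_, ?_⟩
  all_goals
    have hout : ∀ x, ¬ P x → (s * (firstReturn s P)⁻¹ * firstReturn q P) x = s x := by
      intro x hx
      simp only [Equiv.Perm.mul_apply]
      rw [firstReturn_of_not hx, Equiv.Perm.inv_eq_iff_eq.2 (firstReturn_of_not hx).symm]
  · intro x hx
    rw [hout x hx, hs x hx]
  · intro x hx
    obtain ⟨z, hz⟩ := (firstReturn s P).surjective (q x)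
    have hPz : P z := by
      by_contra hPz
      rw [firstReturn_of_not hPz] at hz
      exact hPz (hz ▸ hq x hx)
    refine (hz ▸ hit_firstReturn hPz : Hit s P z (q x)).transfer ?_ hout
    simp only [Equiv.Perm.mul_apply]
    rw [firstReturn_of_invariant hq hx, ← hz, Equiv.Perm.inv_eq_iff_eq.2 rfl]

end FirstReturn

/-! ### Quotients and cycles -/

/-- Two quotients of the same set that identify the same pairs of elements of `P`. -/
theorem exists_equiv_of_quotients {D A B : Type*} {a : D → A} {b : D → B} {P : D → Prop}
    {Q : A → Prop} {R : B → Prop} (hab : ∀ x y, P x → P y → (a x = a y ↔ b x = b y))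
    (hQ : ∀ u, Q u ↔ ∃ x, P x ∧ a x = u) (hR : ∀ v, R v ↔ ∃ x, P x ∧ b x = v) :
    ∃ e : {u // Q u} ≃ {v // R v}, ∀ x, P x → ∀ u, a x = u.1 → (e u).1 = b x := by
  choose s hs using fun u : {u // Q u} => (hQ u.1).1 u.2
  refine ⟨Equiv.ofBijective (fun u => ⟨b (s u), (hR _).2 ⟨s u, (hs u).1, rfl⟩⟩) ⟨?_, ?_⟩, ?_⟩
  · intro u v h
    have h1 := (hab _ _ (hs u).1 (hs v).1).2 (congrArg Subtype.val h)
    rw [(hs u).2, (hs v).2] at h1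
    exact Subtype.ext h1
  · rintro ⟨v, hv⟩
    obtain ⟨x, hx, rfl⟩ := (hR v).1 hv
    refine ⟨⟨a x, (hQ _).2 ⟨x, hx, rfl⟩⟩, Subtype.ext ?_⟩
    exact (hab _ _ (hs _).1 hx).1 (hs _).2
  · intro x hx u hu
    exact (hab _ _ (hs u).1 hx).1 ((hs u).2.trans hu.symm)

theorem sameCycle_map {α β : Type} {p : Equiv.Perm α} {q : Equiv.Perm β} {e : α → β}
    (he : ∀ x, e (p x) = q (e x)) {x y : α} (h : p.SameCycle x y) : q.SameCycle (e x) (e y) := by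
  have key : ∀ n : ℕ, ∀ x, e ((p ^ n) x) = (q ^ n) (e x) := by
    intro n
    induction n with
    | zero => intro x; rfl
    | succ n ih => intro x; rw [pow_succ, pow_succ, Equiv.Perm.mul_apply, ih, he]; rfl
  obtain ⟨n, rfl⟩ := h
  obtain ⟨n, rfl | rfl⟩ := n.eq_nat_or_neg
  · exact ⟨n, by rw [zpow_natCast, zpow_natCast, key]⟩
  · refine Equiv.Perm.SameCycle.symm ⟨n, ?_⟩
    rw [zpow_natCast, ← key, zpow_neg, zpow_natCast, ← Equiv.Perm.mul_apply, mul_inv_cancel,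
      Equiv.Perm.one_apply]

theorem sameCycle_map_iff {α β : Type} {p : Equiv.Perm α} {q : Equiv.Perm β} (e : α ≃ β)
    (he : ∀ x, e (p x) = q (e x)) {x y : α} : p.SameCycle x y ↔ q.SameCycle (e x) (e y) := by
  refine ⟨sameCycle_map he, fun h => ?_⟩
  have := sameCycle_map (e := e.symm) (fun x => by rw [Equiv.symm_apply_eq, he]; simp) h
  simpa using this

theorem sameCycle_iff_of_apply_apply {α : Type} {p : Equiv.Perm α} {x y : α} (h : p (p x) = x) :
    p.SameCycle x y ↔ y = x ∨ y = p x := by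
  constructor
  · rintro ⟨n, rfl⟩
    have hz : (p ^ (2 : ℤ)) x = x := by rw [zpow_two, Equiv.Perm.mul_apply, h]
    have hk : ∀ k : ℤ, (p ^ (2 * k)) x = x := fun k => by
      rw [zpow_mul]
      exact Equiv.Perm.zpow_apply_eq_self_of_apply_eq_self hz k
    obtain ⟨k, rfl | rfl⟩ := n.even_or_odd'
    · exact Or.inl (hk k)
    · refine Or.inr ?_
      rw [add_comm, zpow_add, zpow_one, Equiv.Perm.mul_apply, hk]
  · rintro (rfl | rfl)
    · exact Equiv.Perm.SameCycle.refl _ _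
    · exact Equiv.Perm.sameCycle_apply_right.2 (Equiv.Perm.SameCycle.refl _ _)

theorem card_sameCycle_eq_two_iff {α : Type} [Finite α] {p : Equiv.Perm α} {x : α} :
    Nat.card {y // p.SameCycle x y} = 2 ↔ p x ≠ x ∧ p (p x) = x := by
  change Nat.card {y | p.SameCycle x y} = 2 ↔ _
  rw [Nat.card_coe_set_eq]
  constructor
  · intro h
    have hx : p.SameCycle x x := Equiv.Perm.SameCycle.refl _ _
    have h1 : p x ≠ x := by
      intro h1
      have : {y | p.SameCycle x y} = {x} := by
        ext y
        simp [sameCycle_iff_of_apply_apply (p := p) (x := x) (y := y) (by rw [h1, h1]), h1]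
      rw [this, Set.ncard_singleton] at h
      omega
    refine ⟨h1, ?_⟩
    by_contra h2
    have h3 : ({x, p x, p (p x)} : Set α).ncard = 3 :=
      Set.ncard_eq_three.2 ⟨x, p x, p (p x), Ne.symm h1, Ne.symm h2,
        fun h3 => h1 (p.injective h3).symm, rfl⟩
    have h4 : ({x, p x, p (p x)} : Set α) ⊆ {y | p.SameCycle x y} := by
      rintro y (rfl | rfl | rfl) <;> simp [Equiv.Perm.SameCycle.refl]
    have := Set.ncard_le_ncard h4 (Set.toFinite _)
    omega
  · rintro ⟨h1, h2⟩
    have : {y | p.SameCycle x y} = {x, p x} := by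
      ext y
      exact sameCycle_iff_of_apply_apply h2
    rw [this, Set.ncard_pair (Ne.symm h1)]

/-! ### Face contours of a mobile and successors -/

/-- The combinatorial structure of a mobile on a set of darts: `down d` means that the origin of
`d` is a labeled vertex, whose label is then `lab d`. Genus and connectedness are arbitrary. -/
structure MobileRotation (D : Type) where
  rot : Equiv.Perm D
  rev : Equiv.Perm D
  down : D → Prop
  lab : D → ℤ
  rev_rev : ∀ d, rev (rev d) = d
  down_rev : ∀ d, down (rev d) ↔ ¬ down d
  down_rot : ∀ d, down (rot d) ↔ down d
  lab_rot : ∀ c, down c → lab (rot c) = lab c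
  lab_turn : ∀ c, down c → lab c - 1 ≤ lab (rot⁻¹ (rev (rot⁻¹ (rev c))))

namespace MobileRotation

variable {D : Type} (B : MobileRotation D)

/-- The next labeled corner on the contour of a face of the mobile. -/
def turn : Equiv.Perm D := B.rot⁻¹ * B.rev * B.rot⁻¹ * B.rev

variable {B}

theorem rot_turn (c : D) : B.rot (B.turn c) = B.rev (B.rot⁻¹ (B.rev c)) := by
  simp [turn]

/-- A form without inverses, convenient for transport along isomorphisms. -/
theorem turn_eq_iff {c x : D} : B.turn c = x ↔ B.rot (B.rev (B.rot x)) = B.rev c := by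
  rw [← B.rot.injective.eq_iff, rot_turn]
  constructor
  · intro h
    rw [← h, B.rev_rev]
    simp
  · intro h
    rw [← h]
    simp [B.rev_rev]

theorem down_rot_inv (d : D) : B.down (B.rot⁻¹ d) ↔ B.down d := by
  rw [← B.down_rot]; simp

theorem lab_rot_inv {c : D} (h : B.down c) : B.lab (B.rot⁻¹ c) = B.lab c := by
  rw [← B.lab_rot _ ((down_rot_inv c).2 h)]; simp

theorem down_turn (c : D) : B.down (B.turn c) ↔ B.down c := by
  rw [← B.down_rot, rot_turn, B.down_rev, down_rot_inv, B.down_rev, not_not]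

theorem le_lab_turn {c : D} (h : B.down c) : B.lab c ≤ B.lab (B.turn c) + 1 := by
  have := B.lab_turn c h
  change _ ≤ B.lab (B.turn c) at this
  omega

theorem down_turn_pow (n : ℕ) (c : D) : B.down ((B.turn ^ n) c) ↔ B.down c := by
  induction n with
  | zero => simp
  | succ n ih => rw [pow_succ', Equiv.Perm.mul_apply, down_turn, ih]

theorem down_of_hit_turn {P : D → Prop} {c x : D} (h : Hit B.turn P c x) :
    B.down x ↔ B.down c := by
  obtain ⟨k, _, rfl, _⟩ := h.exists_pow
  exact down_turn_pow k c

/-- Labels fall by at most one per step, so the contour cannot jump below `L` without visiting it.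
-/
theorem le_lab_of_hit_turn {L : ℤ} {c x : D} (hc : B.down c)
    (h : Hit B.turn (fun z => B.lab z ≤ L) c x) (hL : L < B.lab c) : L ≤ B.lab x := by
  induction h with
  | now h => have := le_lab_turn hc; omega
  | later h _ ih => exact ih ((down_turn _).2 hc) (by omega)

theorem exists_hit_turn [Finite D] (c : D) : ∃ x, Hit B.turn (fun z => B.lab z ≤ B.lab c) c x :=
  Hit.exists_of_mem (P := fun z => B.lab z ≤ B.lab c) le_rfl

/-- If the contour does not step down after the labeled corner `c`, the next corner whose label is
at most that of `c` has the same label. -/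
theorem lab_eq_of_hit_turn {c x : D} (hc : B.down c)
    (h : Hit B.turn (fun z => B.lab z ≤ B.lab c) c x) (hle : B.lab c ≤ B.lab (B.turn c)) :
    B.lab x = B.lab c := by
  refine le_antisymm h.mem ?_
  cases h with
  | now _ => exact hle
  | later h1 h2 => exact le_lab_of_hit_turn ((down_turn c).2 hc) h2 (by omega)

/-- The rotation `r` draws, at the labeled corner `c`, the edge to its successor. -/
def ChordAt (B : MobileRotation D) (r : Equiv.Perm D) (c : D) : Prop :=
  (B.lab (B.turn c) < B.lab c → r (B.rev c) = B.rot (B.turn c)) ∧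
  ∀ x, Hit B.turn (fun z => B.lab z ≤ B.lab c) c x → B.lab x = B.lab c → r (B.rev c) = B.rev x

/-- Around the far end of an edge, the up darts come from successive corners of label `L`, with only
larger labels between them, until one whose `turn` steps down: that step reaches the successor.
Requiring the rule at the single level `L` makes the lemma usable inside the induction on labels. -/
theorem hit_turn_of_hit_rot [Finite D] {r : Equiv.Perm D} {L : ℤ}
    (hr : ∀ c, B.down c → B.lab c = L → B.ChordAt r c) {u e : D} (h : Hit r B.down u e)
    (hu : ¬ B.down u) (hL : B.lab (B.rev u) = L) :
    Hit B.turn (fun z => B.lab z < L) (B.rev u) (B.rot⁻¹ e) := by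
  induction h with
  | @now u h =>
    have hd : B.down (B.rev u) := (B.down_rev u).2 hu
    obtain ⟨h1, h2⟩ := hr _ hd hL
    rw [B.rev_rev] at h1 h2
    by_cases hlt : B.lab (B.turn (B.rev u)) < B.lab (B.rev u)
    · refine Hit.now_of_eq ?_ ?_
      · rw [h1 hlt]; simp
      · rw [h1 hlt]; simpa [← hL] using hlt
    · obtain ⟨x, hx⟩ := B.exists_hit_turn (B.rev u)
      have h3 := h2 x hx (lab_eq_of_hit_turn hd hx (not_lt.1 hlt))
      rw [h3, B.down_rev, down_of_hit_turn hx] at h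
      exact absurd hd h
  | @later u e h _ ih =>
    have hd : B.down (B.rev u) := (B.down_rev u).2 hu
    obtain ⟨h1, h2⟩ := hr _ hd hL
    rw [B.rev_rev] at h1 h2
    by_cases hlt : B.lab (B.turn (B.rev u)) < B.lab (B.rev u)
    · rw [h1 hlt, B.down_rot, down_turn] at h
      exact absurd hd h
    · obtain ⟨x, hx⟩ := B.exists_hit_turn (B.rev u)
      have hlab := lab_eq_of_hit_turn hd hx (not_lt.1 hlt)
      have h3 := h2 x hx hlab
      rw [h3, B.rev_rev, ← h3] at ih
      refine hx.trans_of_le (fun w hw => by omega) (by omega) (ih h (by omega))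

/-- The successor of a labeled corner, seen from the edge that leads to it. -/
theorem hit_turn_of_rot_eq_rev [Finite D] {r : Equiv.Perm D} {L : ℤ}
    (hr : ∀ c, B.down c → B.lab c = L → B.ChordAt r c)
    (hB : ∀ c, B.down c → Hit r B.down c (B.rot c)) {b b' : D} (hb : B.down b) (hb' : B.down b')
    (h : r b' = B.rev b) (hL : B.lab b = L) : Hit B.turn (fun z => B.lab z < L) b b' := by
  have h1 := hB b' hb'
  have hu : ¬ B.down (B.rev b) := by rw [B.down_rev, not_not]; exact hb
  have h2 : Hit r B.down (B.rev b) (B.rot b') := by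
    rcases h1.now_or_later with h3 | ⟨_, h3⟩
    · exact absurd ((B.down_rot b').2 hb') (by rwa [← h3, h])
    · rwa [h] at h3
  simpa [B.rev_rev] using hit_turn_of_hit_rot hr h2 hu (by rw [B.rev_rev, hL])

/-- The rule is injective on up darts: its two cases have values of different types, a step down
comes from a permutation, and a corner is the next one of its own level for at most one corner.
`exists_perm_of_hit` then completes it. -/
theorem exists_chordRot [Finite D] (B : MobileRotation D) :
    ∃ r : Equiv.Perm D, (∀ c, B.down c → B.ChordAt r c) ∧
      ∀ c, B.down c → Hit r B.down c (B.rot c) := by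
  classical
  choose nxt hnxt using B.exists_hit_turn
  let g : D → D := fun u =>
    if B.lab (B.turn (B.rev u)) < B.lab (B.rev u) then B.rot (B.turn (B.rev u))
    else B.rev (nxt (B.rev u))
  have hg : Set.InjOn g {u | ¬ B.down u} := by
    intro u hu v hv huv
    have hu' := (B.down_rev u).2 hu
    have hv' := (B.down_rev v).2 hv
    by_cases h1 : B.lab (B.turn (B.rev u)) < B.lab (B.rev u) <;>
    by_cases h2 : B.lab (B.turn (B.rev v)) < B.lab (B.rev v) <;>
    simp only [g, h1, h2, if_true, if_false] at huv
    · exact B.rev.injective (B.turn.injective (B.rot.injective huv))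
    · have : B.down (B.rev (nxt (B.rev v))) := by
        rw [← huv, B.down_rot, down_turn]; exact hu'
      rw [B.down_rev, down_of_hit_turn (hnxt _)] at this
      exact absurd hv' this
    · have : B.down (B.rev (nxt (B.rev u))) := by
        rw [huv, B.down_rot, down_turn]; exact hv'
      rw [B.down_rev, down_of_hit_turn (hnxt _)] at this
      exact absurd hu' this
    · have hx := hnxt (B.rev u)
      have hy := hnxt (B.rev v)
      have hlx := lab_eq_of_hit_turn hu' hx (not_lt.1 h1)
      have hly := lab_eq_of_hit_turn hv' hy (not_lt.1 h2)
      have he := B.rev.injective huv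
      rw [← he] at hy hly
      rw [← hly] at hy
      rw [← hlx] at hx
      refine B.rev.injective (Hit.injective ?_ ?_ hx hy)
      · exact hlx.ge
      · exact hly.ge
  obtain ⟨r, h1, h2⟩ := exists_perm_of_hit hg (q := B.rot) fun c hc => (B.down_rot c).2 hc
  refine ⟨r, fun c hc => ?_, h2⟩
  have hr : r (B.rev c) = g (B.rev c) := h1 _ (by rw [B.down_rev, not_not]; exact hc)
  simp only [g, B.rev_rev] at hr
  constructor
  · intro hlt
    rw [hr, if_pos hlt]
  · intro x hx hlab
    rw [hr, if_neg, (hnxt c).unique hx]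
    intro hlt
    have := (Hit.now hlt.le : Hit B.turn (fun z => B.lab z ≤ B.lab c) c _).unique hx
    rw [this] at hlt
    omega

/-! ### From the successor rule back to the mobile -/

section ChordRot

variable [Finite D] {r : Equiv.Perm D} (hr : ∀ c, B.down c → B.ChordAt r c)
  (hB : ∀ c, B.down c → Hit r B.down c (B.rot c))
include hr

theorem chord_cases {u : D} (hu : ¬ B.down u) :
    (B.lab (B.turn (B.rev u)) = B.lab (B.rev u) - 1 ∧ r u = B.rot (B.turn (B.rev u))) ∨
    ∃ x, Hit B.turn (fun z => B.lab z ≤ B.lab (B.rev u)) (B.rev u) x ∧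
      B.lab x = B.lab (B.rev u) ∧ B.down x ∧ r u = B.rev x := by
  have hd : B.down (B.rev u) := (B.down_rev u).2 hu
  obtain ⟨h1, h2⟩ := hr _ hd
  rw [B.rev_rev] at h1 h2
  by_cases hlt : B.lab (B.turn (B.rev u)) < B.lab (B.rev u)
  · have := le_lab_turn hd
    exact Or.inl ⟨by omega, h1 hlt⟩
  · obtain ⟨x, hx⟩ := B.exists_hit_turn (B.rev u)
    have hlab := lab_eq_of_hit_turn hd hx (not_lt.1 hlt)
    exact Or.inr ⟨x, hx, hlab, (down_of_hit_turn hx).2 hd, h2 x hx hlab⟩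

include hB

/-- From `b` the face contour descends through successors. Each of them is again the first corner
after `c` at or below its own level, so after `n` steps the descent is level with `c` and goes up
along `rev c`. -/
theorem hit_faceRot_of_hit_turn (n : ℕ) {b c : D} (hb : B.down b) (hc : B.down c)
    (hn : B.lab b = B.lab c + n) (h : Hit B.turn (fun z => B.lab z ≤ B.lab b) c b) :
    Hit (r⁻¹ * B.rev) (fun d => ¬ B.down d) b (B.rev c) := by
  have hcu : ¬ B.down (B.rev c) := by rw [B.down_rev, not_not]; exact hc
  have step : ∀ {x y : D}, r y = B.rev x → (r⁻¹ * B.rev) x = y := by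
    intro x y h
    rw [Equiv.Perm.mul_apply, ← h]; simp
  induction n generalizing b with
  | zero =>
    have h0 : B.lab b = B.lab c := by simpa using hn
    rw [h0] at h
    exact Hit.now_of_eq (step ((hr c hc).2 b h h0)) hcu
  | succ n ih =>
    obtain ⟨b', hb'⟩ := r.surjective (B.rev b)
    -- If `b'` were an up dart, the rule would make `b` the next corner of its level after `rev b'`.
    -- It is also so after `c`, whence `rev b' = c`, although `c` has a smaller label.
    have hd : B.down b' := by
      by_contra hu
      rcases chord_cases hr hu with ⟨_, h2⟩ | ⟨x, h1, h2, h3, h4⟩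
      · have : B.down (B.rev b) := by
          rw [← hb', h2, B.down_rot, down_turn, B.down_rev]; exact hu
        exact (B.down_rev b).1 this hb
      · have hxb : x = b := B.rev.injective (h4.symm.trans hb')
        rw [hxb] at h1 h2
        rw [← h2] at h1
        have := Hit.injective (P := fun z => B.lab z ≤ B.lab b) h2.ge
          (by push_cast at hn; omega) h1 h
        rw [this] at h2
        push_cast at hn
        omega
    have h1 := hit_turn_of_rot_eq_rev (fun c hc _ => hr c hc) hB hb hd hb' rfl
    have h1' : Hit B.turn (fun z => B.lab z ≤ B.lab b - 1) b b' :=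
      h1.congr_pred fun z => by omega
    have hl := le_lab_of_hit_turn hb h1' (by omega)
    have hl' := h1.mem
    have h2 : B.lab b' = B.lab b - 1 := by omega
    rw [← h2] at h1'
    refine Hit.later (by rw [step hb', not_not]; exact hd) ?_
    rw [step hb']
    exact ih hd (by push_cast at hn; omega) (h.trans_of_le (fun w hw => by omega) (by omega) h1')

/-- The corner reached by `turn` from `rev (rot d)` lies just before `rev d` in its vertex. If the
label steps down there, the edge of `rev (rot d)` is the last one in that corner and the up darts
are consecutive on the face contour; otherwise the contour descends from that corner. -/
theorem hit_faceRot {d : D} (hd : ¬ B.down d) :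
    Hit (r⁻¹ * B.rev) (fun d => ¬ B.down d) d (B.rot d) := by
  have hd1 : ¬ B.down (B.rot d) := by rwa [B.down_rot]
  have hc1 : B.down (B.rev (B.rot d)) := (B.down_rev _).2 hd1
  have hc0 : B.down (B.rev d) := (B.down_rev _).2 hd
  have step : ∀ {x y : D}, r y = B.rev x → (r⁻¹ * B.rev) x = y := by
    intro x y h
    rw [Equiv.Perm.mul_apply, ← h]; simp
  have hrot : B.rot (B.turn (B.rev (B.rot d))) = B.rev d := by
    rw [rot_turn, B.rev_rev]; simp
  rcases chord_cases hr hd1 with ⟨_, h2⟩ | ⟨x, h1, h2, h3, h4⟩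
  · exact Hit.now_of_eq (step (h2.trans hrot)) hd1
  · have hle : B.lab (B.rev (B.rot d)) ≤ B.lab (B.turn (B.rev (B.rot d))) := by
      by_contra hlt
      have := (Hit.now (not_le.1 hlt).le :
        Hit B.turn (fun z => B.lab z ≤ B.lab (B.rev (B.rot d))) _ _).unique h1
      rw [this] at hlt
      omega
    have hc' : B.down (B.turn (B.rev (B.rot d))) := (down_turn _).2 hc1
    -- This corner receives no edge: the last one would come from the corner preceding it under
    -- `turn`, where the label does not step down.
    have hfirst : r (B.turn (B.rev (B.rot d))) = B.rev d := by
      rcases (hB _ hc').last_step with h | ⟨u, hu, h⟩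
      · rw [h, hrot]
      · rw [hrot] at h
        rcases chord_cases hr hu with ⟨h5, h6⟩ | ⟨y, _, _, h7, h8⟩
        · have h9 := B.turn.injective (B.rot.injective ((h6.symm.trans h).trans hrot.symm))
          rw [h9] at h5
          omega
        · rw [h8] at h
          rw [← h, B.down_rev] at hc0
          exact absurd h7 hc0
    refine Hit.later (by rw [step hfirst, not_not]; exact hc') ?_
    rw [step hfirst]
    have := hit_faceRot_of_hit_turn hr hB
      (B.lab (B.turn (B.rev (B.rot d))) - B.lab (B.rev (B.rot d))).toNat hc' hc1 (by omega)
      (Hit.now le_rfl)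
    rwa [B.rev_rev] at this

end ChordRot

/-! ### From a labeled map to the successor rule -/

section OfRotation

variable [Finite D] {r : Equiv.Perm D} (hdown : ∀ c, B.down c → Hit r B.down c (B.rot c))
  (hup : ∀ d, ¬ B.down d → Hit (r⁻¹ * B.rev) (fun d => ¬ B.down d) d (B.rot d))
  (hlab : ∀ d, B.lab (r d) = B.lab d) (hrev : ∀ c, B.down c → B.lab (B.rev c) = B.lab c - 1)
include hdown hup hlab hrev

/-- Trace the map face having `rev c` on its contour, from the preceding up dart to `rev c`. The
down steps in between start above the level of `c`, except the last one, so the rule at higher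
labels identifies their ends as successors. -/
theorem chordAt_step {L : ℤ} (ih : ∀ c, B.down c → L < B.lab c → B.ChordAt r c) {c : D}
    (hc : B.down c) (hL : B.lab c = L) : B.ChordAt r c := by
  have step : ∀ {x y : D}, (r⁻¹ * B.rev) x = y → r y = B.rev x := by
    intro x y h
    rw [← h]; simp
  have hcu : ¬ B.down (B.rev c) := by rw [B.down_rev, not_not]; exact hc
  have hle := le_lab_turn hc
  by_cases hd : B.down (r (B.rev c))
  · have h1 : B.rot (B.rev (r (B.rev c))) = B.rev c := by
      have hu : ¬ B.down (B.rev (r (B.rev c))) := by rw [B.down_rev, not_not]; exact hd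
      refine (hup _ hu).unique (Hit.now_of_eq ?_ hcu)
      simp [B.rev_rev]
    have h2 : B.turn c = B.rot⁻¹ (r (B.rev c)) := by
      rw [turn_eq_iff]
      simp [h1]
    have h3 : B.lab (B.turn c) = B.lab c - 1 := by
      rw [h2, lab_rot_inv hd, hlab, hrev c hc]
    refine ⟨fun _ => by rw [h2]; simp, fun x hx hxc => ?_⟩
    have := (Hit.now (show B.lab (B.turn c) ≤ B.lab c by omega) :
        Hit B.turn (fun z => B.lab z ≤ B.lab c) _ _).unique hx
    rw [this] at h3
    omega
  · -- the last down dart before `rev c` on the contour of the face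
    have key : ∀ b u, Hit (r⁻¹ * B.rev) (fun d => ¬ B.down d) b u → B.down b → u = B.rev c →
        ∃ x, B.down x ∧ r (B.rev c) = B.rev x ∧ B.lab x = B.lab c ∧
          (b = x ∨ B.lab c < B.lab b ∧ Hit B.turn (fun z => B.lab z ≤ B.lab c) b x) := by
      intro b u h
      induction h with
      | @now b h =>
        intro hb hbu
        have h1 := step hbu
        refine ⟨b, hb, h1, ?_, Or.inl rfl⟩
        have := hrev b hb
        rw [← h1, hlab, hrev c hc] at this
        omega
      | @later b u h _ ih' =>
        intro hb hbu
        rw [not_not] at h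
        obtain ⟨x, hx, h1, h2, h3⟩ := ih' h hbu
        have h4 : r ((r⁻¹ * B.rev) b) = B.rev b := step rfl
        have h5 : B.lab ((r⁻¹ * B.rev) b) = B.lab b - 1 := by rw [← hrev b hb, ← h4, hlab]
        have h6 : B.lab c < B.lab b := by
          rcases h3 with h3 | h3
          · rw [h3, h2] at h5; omega
          · omega
        have h7 := hit_turn_of_rot_eq_rev
          (fun c' hc' hl => ih c' hc' (by omega)) hdown hb h h4 rfl
        refine ⟨x, hx, h1, h2, Or.inr ⟨h6, ?_⟩⟩
        rcases h3 with h3 | ⟨h3, h8⟩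
        · rw [h3] at h5 h7
          exact h7.congr_pred fun z => by omega
        · exact h7.trans_of_le (fun w hw => by omega) (by omega) h8
    -- This is the preceding up dart of the face; the first down dart after it is `turn c`.
    have he : ¬ B.down (B.rot⁻¹ (B.rev c)) := by rwa [down_rot_inv]
    have h1 := hup _ he
    rw [show B.rot (B.rot⁻¹ (B.rev c)) = B.rev c by simp] at h1
    obtain ⟨x, hx, h2, h3, h4⟩ : ∃ x, B.down x ∧ r (B.rev c) = B.rev x ∧ B.lab x = B.lab c ∧
        (B.turn c = x ∨ B.lab c < B.lab (B.turn c) ∧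
          Hit B.turn (fun z => B.lab z ≤ B.lab c) (B.turn c) x) := by
      rcases h1.now_or_later with h5 | ⟨h5, h6⟩
      · exact absurd (by rw [step h5, B.down_rev]; exact he) hd
      · rw [not_not] at h5
        have h8 := step (rfl : (r⁻¹ * B.rev) (B.rot⁻¹ (B.rev c)) = _)
        have h9 : B.turn c = (r⁻¹ * B.rev) (B.rot⁻¹ (B.rev c)) := by
          rw [turn_eq_iff, (hdown _ h5).unique (Hit.now_of_eq h8 ?_), B.rev_rev]
          · simp
          · rw [B.down_rev]; exact he
        rw [h9]
        exact key _ _ h6 h5 rfl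
    have hhit : Hit B.turn (fun z => B.lab z ≤ B.lab c) c x := by
      rcases h4 with h4 | ⟨h4, h5⟩
      · exact Hit.now_of_eq h4 h3.le
      · exact Hit.later (by omega) h5
    refine ⟨fun hlt => ?_, fun y hy _ => by rw [h2, hhit.unique hy]⟩
    rcases h4 with h4 | ⟨h4, h5⟩
    · rw [h4] at hlt; omega
    · omega

/-- Downward induction on labels, which are bounded above because there are finitely many darts. -/
theorem chordAt_of_rotation {c : D} (hc : B.down c) : B.ChordAt r c := by
  obtain ⟨K, hK⟩ := (Set.finite_range B.lab).bddAbove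
  have hK' : ∀ c, B.lab c ≤ K := fun c => hK ⟨c, rfl⟩
  suffices ∀ n : ℕ, ∀ c, B.down c → K - B.lab c = n → B.ChordAt r c from
    this (K - B.lab c).toNat c hc (by have := hK' c; omega)
  intro n
  induction n using Nat.strong_induction_on with
  | _ n ih =>
    intro c hc hn
    refine chordAt_step hdown hup hlab hrev (fun c' hc' hlt => ?_) hc rfl
    have := hK' c'
    exact ih (K - B.lab c').toNat (by omega) c' hc' (by omega)

end OfRotation

/-! ### Local min and minimal corners -/

section Minima

variable [Finite D] {r : Equiv.Perm D} (hr : ∀ c, B.down c → B.ChordAt r c)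
include hr

/-- The edges drawn from the corners of minimal label in a face of the mobile end at the same
vertex, which has no down dart. -/
theorem not_down_of_minimal {c : D} (hc : B.down c)
    (hmin : ∀ n : ℕ, B.lab c ≤ B.lab ((B.turn ^ n) c)) {d : D} (hd : r.SameCycle (B.rev c) d) :
    ¬ B.down d := by
  obtain ⟨k, rfl⟩ := hd.exists_nat_pow_eq
  suffices ∃ m : ℕ, (r ^ k) (B.rev c) = B.rev ((B.turn ^ m) c) ∧
      B.lab ((B.turn ^ m) c) = B.lab c by
    obtain ⟨m, h1, _⟩ := this
    rw [h1, B.down_rev, down_turn_pow, not_not]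
    exact hc
  clear hd
  induction k with
  | zero => exact ⟨0, by simp, by simp⟩
  | succ k ih =>
    obtain ⟨m, h1, h2⟩ := ih
    have hu : ¬ B.down (B.rev ((B.turn ^ m) c)) := by
      rw [B.down_rev, down_turn_pow, not_not]; exact hc
    rw [pow_succ', Equiv.Perm.mul_apply, h1]
    rcases chord_cases hr hu with ⟨h3, _⟩ | ⟨x, h3, h4, _, h5⟩
    · rw [B.rev_rev, ← Equiv.Perm.mul_apply, ← pow_succ', h2] at h3
      have := hmin (m + 1)
      omega
    · rw [B.rev_rev] at h3 h4
      obtain ⟨j, _, rfl, _⟩ := h3.exists_pow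
      have hadd : (B.turn ^ j) ((B.turn ^ m) c) = (B.turn ^ (j + m)) c := by rw [pow_add]; rfl
      rw [hadd] at h4 h5
      exact ⟨j + m, h5, h4.trans h2⟩

/-- Without down darts only the second case of the rule occurs, so the rotation never leaves the
face of the mobile. -/
theorem exists_turn_pow_of_not_down {c : D} (hc : B.down c)
    (h : ∀ d, r.SameCycle (B.rev c) d → ¬ B.down d) {d : D} (hd : r.SameCycle (B.rev c) d) :
    ∃ m : ℕ, d = B.rev ((B.turn ^ m) c) := by
  obtain ⟨k, rfl⟩ := hd.exists_nat_pow_eq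
  clear hd
  induction k with
  | zero => exact ⟨0, by simp⟩
  | succ k ih =>
    obtain ⟨m, h1⟩ := ih
    have hu : ¬ B.down (B.rev ((B.turn ^ m) c)) := by
      rw [B.down_rev, down_turn_pow, not_not]; exact hc
    have hk : ¬ B.down ((r ^ (k + 1)) (B.rev c)) := h _ ⟨(k + 1 : ℕ), by rw [zpow_natCast]⟩
    rw [pow_succ', Equiv.Perm.mul_apply, h1] at hk ⊢
    rcases chord_cases hr hu with ⟨_, h2⟩ | ⟨x, h3, _, _, h5⟩
    · rw [h2, B.down_rot, down_turn, B.rev_rev, down_turn_pow] at hk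
      exact absurd hc hk
    · rw [B.rev_rev] at h3
      obtain ⟨j, _, rfl, _⟩ := h3.exists_pow
      exact ⟨j + m, by rw [h5, pow_add]; rfl⟩

/-- The rotation around the vertex jumps from `c` to the next corner of label at most `lab c`, which
has the same label; all corners skipped are strictly higher. Iterating covers the whole contour. -/
theorem minimal_of_not_down {c : D} (hc : B.down c)
    (h : ∀ d, r.SameCycle (B.rev c) d → ¬ B.down d) (n : ℕ) :
    B.lab c ≤ B.lab ((B.turn ^ n) c) ∧
      (B.lab ((B.turn ^ n) c) = B.lab c → r.SameCycle (B.rev c) (B.rev ((B.turn ^ n) c))) := by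
  induction n using Nat.strong_induction_on generalizing c with
  | _ n ih =>
    rcases Nat.eq_zero_or_pos n with rfl | hn
    · simp [Equiv.Perm.SameCycle.refl]
    have hu : ¬ B.down (B.rev c) := h _ (Equiv.Perm.SameCycle.refl _ _)
    have hstep : r.SameCycle (B.rev c) (r (B.rev c)) :=
      Equiv.Perm.sameCycle_apply_right.2 (Equiv.Perm.SameCycle.refl _ _)
    rcases chord_cases hr hu with ⟨_, h2⟩ | ⟨x, h1, h2, h3, h4⟩
    · refine absurd ?_ (h _ hstep)
      rw [h2, B.down_rot, down_turn, B.rev_rev]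
      exact hc
    · rw [B.rev_rev] at h1 h2
      obtain ⟨k, h5, h6, h7⟩ := h1.exists_pow
      rcases lt_or_ge n k with hlt | hle
      · have := h7 n hn hlt
        exact ⟨by omega, fun h8 => by omega⟩
      · rw [h4] at hstep
        have := ih (n - k) (by omega) h3 fun d hd => h d (hstep.trans hd)
        rw [← h6, ← Equiv.Perm.mul_apply, ← pow_add, Nat.sub_add_cancel hle, h6, h2] at this
        exact ⟨this.1, fun h8 => hstep.trans (this.2 h8)⟩

end Minima

end MobileRotation

/-! ### Degrees and connectedness of combinatorial maps -/

namespace CombMap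

variable (C : CombMap)

instance : Finite C.Dart := C.finite_dart
instance : Finite C.Vertex := Quotient.finite _
instance : Finite C.Edge := Quotient.finite _
instance : Finite C.Face := Quotient.finite _

variable {C}

theorem origin_eq_iff {x y : C.Dart} : C.origin x = C.origin y ↔ C.rot.SameCycle x y :=
  Quotient.eq''

theorem edge_eq_iff {x y : C.Dart} : C.edge x = C.edge y ↔ C.rev.SameCycle x y :=
  Quotient.eq''

theorem leftFace_eq_iff {x y : C.Dart} : C.leftFace x = C.leftFace y ↔ C.faceRot.SameCycle x y :=
  Quotient.eq''

theorem exists_origin (v : C.Vertex) : ∃ d, C.origin d = v := Quotient.exists_rep v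
theorem exists_edge (e : C.Edge) : ∃ d, C.edge d = e := Quotient.exists_rep e
theorem exists_leftFace (f : C.Face) : ∃ d, C.leftFace d = f := Quotient.exists_rep f

theorem origin_rot (d : C.Dart) : C.origin (C.rot d) = C.origin d :=
  origin_eq_iff.2 (Equiv.Perm.sameCycle_apply_left.2 (Equiv.Perm.SameCycle.refl _ _))

theorem rot_faceRot (d : C.Dart) : C.rot (C.faceRot d) = C.rev d := by
  simp [faceRot]

theorem faceRot_eq_iff {x y : C.Dart} : C.faceRot x = y ↔ C.rot y = C.rev x := by
  rw [← C.rot.injective.eq_iff, rot_faceRot, eq_comm]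

theorem origin_faceRot (d : C.Dart) : C.origin (C.faceRot d) = C.origin (C.rev d) := by
  rw [← origin_rot, rot_faceRot]

theorem leftFace_faceRot (d : C.Dart) : C.leftFace (C.faceRot d) = C.leftFace d :=
  leftFace_eq_iff.2 (Equiv.Perm.sameCycle_apply_left.2 (Equiv.Perm.SameCycle.refl _ _))

theorem edge_rev (d : C.Dart) : C.edge (C.rev d) = C.edge d :=
  edge_eq_iff.2 (Equiv.Perm.sameCycle_apply_left.2 (Equiv.Perm.SameCycle.refl _ _))

theorem vertexDegree_origin_eq_two_iff {d : C.Dart} :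
    C.vertexDegree (C.origin d) = 2 ↔ C.rot d ≠ d ∧ C.rot (C.rot d) = d := by
  rw [← card_sameCycle_eq_two_iff, vertexDegree]
  exact iff_of_eq (congrArg (· = 2) (Nat.card_congr
    (Equiv.subtypeEquivRight fun c => eq_comm.trans origin_eq_iff)))

theorem card_dart : Nat.card C.Dart = 2 * Nat.card C.Edge := by
  have := Fintype.ofFinite C.Edge
  have h : ∀ e, Nat.card {d // C.edge d = e} = 2 := by
    intro e
    obtain ⟨d, rfl⟩ := C.exists_edge e
    rw [Nat.card_congr (Equiv.subtypeEquivRight fun c => eq_comm.trans edge_eq_iff)]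
    exact card_sameCycle_eq_two_iff.2 ⟨C.rev_ne d, C.rev_rev d⟩
  rw [← Nat.card_congr (Equiv.sigmaFiberEquiv C.edge), Nat.card_sigma]
  simp [h, mul_comm]

/-- Connectedness in terms of sets of darts that are invariant under both permutations. -/
theorem isPretransitive_iff :
    MulAction.IsPretransitive (Subgroup.closure {C.rot, C.rev}) C.Dart ↔
      ∀ S : C.Dart → Prop, (∀ d, S (C.rot d) = S d) → (∀ d, S (C.rev d) = S d) →
        ∀ x y, S x → S y := by
  constructor
  · intro h S h1 h2 x y hx
    obtain ⟨⟨g, hg⟩, rfl⟩ := h.exists_smul_eq x y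
    change S (g x)
    suffices ∀ z, S (g z) = S z by rwa [this]
    clear hx
    induction hg using Subgroup.closure_induction with
    | mem g hg =>
      rcases hg with rfl | rfl
      · exact h1
      · exact h2
    | one => intro z; rfl
    | mul a b _ _ ha hb => intro z; rw [Equiv.Perm.mul_apply, ha, hb]
    | inv a _ ha => intro z; rw [← ha]; simp
  · intro h
    refine ⟨fun x y => ?_⟩
    have key : ∀ (g : Equiv.Perm C.Dart), g ∈ ({C.rot, C.rev} : Set (Equiv.Perm C.Dart)) →
        ∀ d, (g d ∈ MulAction.orbit (Subgroup.closure {C.rot, C.rev}) x) =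
          (d ∈ MulAction.orbit (Subgroup.closure {C.rot, C.rev}) x) := by
      intro g hg d
      let γ : Subgroup.closure {C.rot, C.rev} := ⟨g, Subgroup.subset_closure hg⟩
      refine propext ⟨fun h => ?_, fun h => MulAction.mem_orbit_of_mem_orbit γ h⟩
      have h1 := MulAction.mem_orbit_of_mem_orbit γ⁻¹ h
      rwa [show γ⁻¹ • g d = d from inv_smul_smul γ d] at h1
    exact h (fun d => d ∈ MulAction.orbit (Subgroup.closure {C.rot, C.rev}) x)
      (key _ (by simp)) (key _ (by simp)) x y (MulAction.mem_orbit_self x)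

end CombMap

/-! ### The mobile of a labeled map: components and genus -/

namespace LabeledMap

open CombMap

theorem isDown_mobileRot {M : LabeledMap ℤ} (d : M.Dart) :
    M.IsDown (M.mobileRot d) ↔ M.IsDown d :=
  (M.mobileRot_same_orbit d).1

theorem isDown_mobileRot_inv {M : LabeledMap ℤ} (d : M.Dart) :
    M.IsDown (M.mobileRot⁻¹ d) ↔ M.IsDown d := by
  rw [← isDown_mobileRot]; simp

theorem label_mobileRot_inv {M : LabeledMap ℤ} {d : M.Dart} (h : M.IsDown d) :
    M.label (M.origin (M.mobileRot⁻¹ d)) = M.label (M.origin d) := by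
  rw [← (M.mobileRot_same_orbit _).2 ((isDown_mobileRot_inv d).2 h)]
  simp

theorem label_mobileOf_of_isDown {M : LabeledMap ℤ} {d : M.Dart} (h : M.IsDown d) :
    M.mobileOf.label (M.mobileOf.origin d) = some (M.label (M.origin d)) :=
  if_pos h

theorem label_mobileOf_of_not_isDown {M : LabeledMap ℤ} {d : M.Dart} (h : ¬ M.IsDown d) :
    M.mobileOf.label (M.mobileOf.origin d) = none :=
  if_neg h

theorem label_mobileOf_eq_none_iff {M : LabeledMap ℤ} (d : M.Dart) :
    M.mobileOf.label (M.mobileOf.origin d) = none ↔ ¬ M.IsDown d := by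
  by_cases h : M.IsDown d
  · simp [label_mobileOf_of_isDown h, h]
  · simp [label_mobileOf_of_not_isDown h, h]

/-- The labels of adjacent vertices differ by exactly one; the genus is arbitrary. -/
def HasUnitSteps (M : LabeledMap ℤ) : Prop :=
  ∀ d, |M.label (M.origin (M.rev d)) - M.label (M.origin d)| = 1

namespace HasUnitSteps

variable {M : LabeledMap ℤ} (hM : M.HasUnitSteps)
include hM

theorem isUp_iff (d : M.Dart) : M.IsUp d ↔ ¬ M.IsDown d := by
  have h := hM d
  unfold IsUp IsDown
  constructor
  · omega
  · intro h1
    rcases lt_or_eq_of_le (not_lt.1 h1) with h2 | h2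
    · exact h2
    · rw [h2] at h; simp at h

theorem isDown_rev (d : M.Dart) : M.IsDown (M.rev d) ↔ ¬ M.IsDown d := by
  rw [← hM.isUp_iff]
  unfold IsDown IsUp
  rw [M.rev_rev]

theorem label_of_isDown {d : M.Dart} (h : M.IsDown d) :
    M.label (M.origin (M.rev d)) = M.label (M.origin d) - 1 := by
  have h1 := hM d
  unfold IsDown at h
  rw [abs_of_neg (by omega)] at h1
  omega

theorem label_of_not_isDown {d : M.Dart} (h : ¬ M.IsDown d) :
    M.label (M.origin (M.rev d)) = M.label (M.origin d) + 1 := by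
  have := hM.label_of_isDown ((hM.isDown_rev d).2 h)
  rw [M.rev_rev] at this
  omega

theorem hit_rot {d : M.Dart} (h : M.IsDown d) : Hit M.rot M.IsDown d (M.mobileRot d) := by
  rw [mobileRot, Equiv.Perm.mul_apply,
    firstReturn_of_not (p := M.faceRot) (fun h' => (hM.isUp_iff d).1 h' h)]
  exact hit_firstReturn h

theorem hit_faceRot {d : M.Dart} (h : ¬ M.IsDown d) :
    Hit M.faceRot (fun d => ¬ M.IsDown d) d (M.mobileRot d) := by
  have h1 := hit_firstReturn (p := M.faceRot) ((hM.isUp_iff d).2 h)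
  rw [mobileRot, Equiv.Perm.mul_apply, firstReturn_of_not]
  · exact h1.congr_pred hM.isUp_iff
  · exact (hM.isUp_iff _).1 h1.mem

/-- Between two consecutive up darts the face contour only goes down. -/
theorem label_le_of_hit {x y : M.Dart} (h : Hit M.faceRot (fun d => ¬ M.IsDown d) x y) :
    M.label (M.origin y) ≤ M.label (M.origin (M.rev x)) := by
  induction h with
  | now _ => rw [origin_faceRot]
  | later h _ ih =>
    rw [not_not] at h
    have h1 := hM.label_of_isDown h
    rw [origin_faceRot] at h1
    omega

/-- This is the mobile inequality: the up dart following another one on a face starts no higher than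
the latter ends, and ends one above its start. -/
theorem label_rev_mobileRot_inv {d : M.Dart} (h : ¬ M.IsDown d) :
    M.label (M.origin (M.rev d)) - 1 ≤ M.label (M.origin (M.rev (M.mobileRot⁻¹ d))) := by
  have h2 := hM.hit_faceRot ((isDown_mobileRot_inv _).not.2 h)
  rw [show M.mobileRot (M.mobileRot⁻¹ d) = d by simp] at h2
  have h3 := hM.label_le_of_hit h2
  rw [hM.label_of_not_isDown h]
  omega

/-- The mobile of a labeled map as a rotation system. -/
noncomputable def mobileRotation : MobileRotation M.Dart where
  rot := M.mobileRot
  rev := M.rev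
  down := M.IsDown
  lab d := M.label (M.origin d)
  rev_rev := M.rev_rev
  down_rev := hM.isDown_rev
  down_rot := isDown_mobileRot
  lab_rot c hc := congrArg M.label ((M.mobileRot_same_orbit c).2 hc)
  lab_turn c hc := by
    rw [label_mobileRot_inv]
    · have h := hM.label_rev_mobileRot_inv fun h => (hM.isDown_rev c).1 h hc
      rwa [M.rev_rev] at h
    · rw [hM.isDown_rev, isDown_mobileRot_inv, hM.isDown_rev, not_not]
      exact hc

theorem chordAt {c : M.Dart} (hc : M.IsDown c) : hM.mobileRotation.ChordAt M.rot c :=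
  hM.mobileRotation.chordAt_of_rotation (fun _ h => hM.hit_rot h) (fun _ h => hM.hit_faceRot h)
    (fun d => congrArg M.label (origin_rot d)) (fun _ h => hM.label_of_isDown h) hc

theorem isLocalMin_iff (v : M.Vertex) :
    M.IsLocalMin v ↔ ∀ d, M.origin d = v → ¬ M.IsDown d := by
  constructor
  · intro h d hd hd'
    have := h d hd
    subst hd
    exact lt_asymm this hd'
  · rintro h d rfl
    have := hM.label_of_not_isDown (h d rfl)
    omega

theorem not_isLocalMin_iff (v : M.Vertex) :
    ¬ M.IsLocalMin v ↔ ∃ d, M.IsDown d ∧ M.origin d = v := by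
  rw [hM.isLocalMin_iff]
  push Not
  exact exists_congr fun d => and_comm

theorem isDown_faceRot_mobileOf (d : M.Dart) :
    M.IsDown (M.mobileOf.faceRot d) ↔ ¬ M.IsDown d := by
  rw [← hM.isDown_rev]
  exact isDown_mobileRot_inv _

/-- Mobile contours alternate between labeled and unlabeled corners, so `turn` is the first return
to labeled ones. -/
theorem sameCycle_turn_iff {x y : M.Dart} (hx : M.IsDown x) (hy : M.IsDown y) :
    hM.mobileRotation.turn.SameCycle x y ↔ M.mobileOf.leftFace x = M.mobileOf.leftFace y := by
  refine Iff.trans ?_ (leftFace_eq_iff (C := M.mobileOf.toCombMap)).symm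
  refine sameCycle_iff_of_hit (p := M.mobileOf.faceRot) (P := M.IsDown) (fun d hd => ?_) hx hy
  have h1 : ¬ M.IsDown (M.mobileOf.faceRot d) := by
    exact fun h => (hM.isDown_faceRot_mobileOf d).1 h hd
  exact .later h1 (.now ((hM.isDown_faceRot_mobileOf _).2 h1))

/-- Edges into one local min come from one mobile face. Conversely, two such corners in the same
face both have its minimal label, so their edges share their lower end. -/
theorem leftFace_mobileOf_eq_iff {x y : M.Dart} (hx : M.IsDown x) (hy : M.IsDown y)
    (hvx : M.IsLocalMin (M.origin (M.rev x))) (hvy : M.IsLocalMin (M.origin (M.rev y))) :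
    M.origin (M.rev x) = M.origin (M.rev y) ↔
      M.mobileOf.leftFace x = M.mobileOf.leftFace y := by
  have hr : ∀ c, hM.mobileRotation.down c → hM.mobileRotation.ChordAt M.rot c :=
    fun _ h => hM.chordAt h
  have hx' : ∀ d, M.rot.SameCycle (M.rev x) d → ¬ M.IsDown d :=
    fun d hd => (hM.isLocalMin_iff _).1 hvx d (origin_eq_iff.2 hd).symm
  have hy' : ∀ d, M.rot.SameCycle (M.rev y) d → ¬ M.IsDown d :=
    fun d hd => (hM.isLocalMin_iff _).1 hvy d (origin_eq_iff.2 hd).symm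
  rw [← hM.sameCycle_turn_iff hx hy, origin_eq_iff]
  constructor
  · intro h
    obtain ⟨n, hn⟩ := MobileRotation.exists_turn_pow_of_not_down hr hx hx' h
    exact ⟨n, by rw [zpow_natCast]; exact (M.rev.injective hn).symm⟩
  · intro h
    obtain ⟨n, hn⟩ := h.exists_nat_pow_eq
    obtain ⟨m, hm⟩ := h.symm.exists_nat_pow_eq
    have h1 := MobileRotation.minimal_of_not_down hr hx hx' n
    have h2 := (MobileRotation.minimal_of_not_down hr hy hy' m).1
    rw [hn] at h1
    rw [hm] at h2
    exact h1.2 (le_antisymm h2 h1.1)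

/-- Take a labeled corner of minimal label in the face: its edge descends to a vertex with no down
dart. -/
theorem exists_isLocalMin_of_face (f : M.mobileOf.Face) :
    ∃ d, (M.IsDown d ∧ M.IsLocalMin (M.origin (M.rev d))) ∧ M.mobileOf.leftFace d = f := by
  obtain ⟨c, hc, rfl⟩ : ∃ c, M.IsDown c ∧ M.mobileOf.leftFace c = f := by
    obtain ⟨d, rfl⟩ := M.mobileOf.exists_leftFace f
    by_cases hd : M.IsDown d
    · exact ⟨d, hd, rfl⟩
    · exact ⟨_, (hM.isDown_faceRot_mobileOf d).2 hd, leftFace_faceRot d⟩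
  obtain ⟨_, ⟨n, rfl⟩, hn⟩ := Set.exists_min_image
    (Set.range fun n : ℕ => (hM.mobileRotation.turn ^ n) c) (fun d => M.label (M.origin d))
    (Set.toFinite _) ⟨_, 0, rfl⟩
  have hd : M.IsDown ((hM.mobileRotation.turn ^ n) c) :=
    (MobileRotation.down_turn_pow (B := hM.mobileRotation) n c).2 hc
  refine ⟨(hM.mobileRotation.turn ^ n) c, ⟨hd, ?_⟩, ?_⟩
  · rw [hM.isLocalMin_iff]
    intro d hd'
    refine MobileRotation.not_down_of_minimal (B := hM.mobileRotation) (fun _ h => hM.chordAt h)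
      hd (fun m => ?_) (origin_eq_iff.1 hd'.symm)
    refine hn _ ⟨m + n, ?_⟩
    simp only [pow_add, Equiv.Perm.mul_apply]
  · rw [← hM.sameCycle_turn_iff hd hc]
    exact Equiv.Perm.SameCycle.symm ⟨n, by rw [zpow_natCast]⟩

theorem exists_minFace :
    ∃ e : {v : M.Vertex // M.IsLocalMin v} ≃ M.mobileOf.Face,
      ∀ v d, M.IsDown d → M.origin (M.rev d) = v.1 → e v = M.mobileOf.leftFace d := by
  obtain ⟨e, he⟩ := exists_equiv_of_quotients (a := fun d => M.origin (M.rev d))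
    (b := M.mobileOf.leftFace) (P := fun d => M.IsDown d ∧ M.IsLocalMin (M.origin (M.rev d)))
    (Q := M.IsLocalMin) (R := fun _ => True)
    (fun x y hx hy => hM.leftFace_mobileOf_eq_iff hx.1 hy.1 hx.2 hy.2)
    (fun v => ⟨fun hv => by
      obtain ⟨d, rfl⟩ := M.exists_origin v
      refine ⟨M.rev d, ⟨?_, ?_⟩, ?_⟩
      · exact (hM.isDown_rev d).2 ((hM.isLocalMin_iff _).1 hv d rfl)
      · rwa [M.rev_rev]
      · rw [M.rev_rev], by rintro ⟨d, hd, rfl⟩; exact hd.2⟩)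
    (fun f => ⟨fun _ => hM.exists_isLocalMin_of_face f, fun _ => trivial⟩)
  refine ⟨e.trans (Equiv.subtypeUnivEquiv fun _ => trivial), fun v d hd hv => ?_⟩
  exact he d ⟨hd, hv ▸ v.2⟩ v hv

theorem origin_eq_iff_of_isDown {x y : M.Dart} (hx : M.IsDown x) (hy : M.IsDown y) :
    M.origin x = M.origin y ↔ M.mobileOf.origin x = M.mobileOf.origin y := by
  refine origin_eq_iff.trans (Iff.trans ?_ (origin_eq_iff (C := M.mobileOf.toCombMap)).symm)
  exact (sameCycle_iff_of_hit (fun d hd => hM.hit_rot hd) hx hy).symm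

theorem leftFace_eq_iff_of_not_isDown {x y : M.Dart} (hx : ¬ M.IsDown x) (hy : ¬ M.IsDown y) :
    M.leftFace x = M.leftFace y ↔ M.mobileOf.origin x = M.mobileOf.origin y := by
  refine leftFace_eq_iff.trans (Iff.trans ?_ (origin_eq_iff (C := M.mobileOf.toCombMap)).symm)
  exact (sameCycle_iff_of_hit (P := fun d => ¬ M.IsDown d) (fun d hd => hM.hit_faceRot hd)
    hx hy).symm

theorem exists_nonMinVertex :
    ∃ e : {v : M.Vertex // ¬ M.IsLocalMin v} ≃
        {w : M.mobileOf.Vertex // M.mobileOf.label w ≠ none},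
      ∀ v d, M.IsDown d → M.origin d = v.1 → (e v).1 = M.mobileOf.origin d := by
  obtain ⟨e, he⟩ := exists_equiv_of_quotients (a := M.origin) (b := M.mobileOf.origin)
    (P := M.IsDown) (Q := fun v => ¬ M.IsLocalMin v) (R := fun w => M.mobileOf.label w ≠ none)
    (fun x y hx hy => hM.origin_eq_iff_of_isDown hx hy) hM.not_isLocalMin_iff
    (fun w => by
      obtain ⟨d, rfl⟩ := M.mobileOf.exists_origin w
      refine ⟨fun h => ⟨d, not_not.1 ((label_mobileOf_eq_none_iff d).not.1 h), rfl⟩, ?_⟩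
      rintro ⟨x, hx, hxd⟩ hd
      exact (label_mobileOf_eq_none_iff x).1 (hxd ▸ hd) hx)
  exact ⟨e, fun v d hd hv => he d hd v hv⟩

/-- Along the contour of a face there are as many steps up as steps down. -/
theorem faceDegree_eq (f : M.Face) :
    M.faceDegree f = 2 * Nat.card {c : M.Dart // M.leftFace c = f ∧ ¬ M.IsDown c} := by
  classical
  have := Fintype.ofFinite M.Dart
  rw [faceDegree, Nat.card_eq_fintype_card, Nat.card_eq_fintype_card, Fintype.card_subtype,
    Fintype.card_subtype, ← Finset.filter_filter]
  set S := Finset.univ.filter fun c => M.leftFace c = f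
  -- `faceRot` permutes the darts of the face and so preserves the sum of labels, while each up or
  -- down dart changes it by `1` or `-1`.
  have h1 : ∑ c ∈ S, M.label (M.origin (M.faceRot c)) = ∑ c ∈ S, M.label (M.origin c) :=
    Finset.sum_equiv M.faceRot (by simp [S, leftFace_faceRot]) (fun _ _ => rfl)
  have h2 : ∑ c ∈ S, M.label (M.origin (M.faceRot c)) =
      ∑ c ∈ S, (M.label (M.origin c) + (2 * (if ¬ M.IsDown c then 1 else 0) - 1)) := by
    refine Finset.sum_congr rfl fun c _ => ?_
    rw [origin_faceRot]
    by_cases hc : M.IsDown c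
    · rw [hM.label_of_isDown hc, if_neg (not_not.2 hc)]; ring
    · rw [hM.label_of_not_isDown hc, if_pos hc]; ring
  rw [Finset.sum_add_distrib, h1, Finset.sum_sub_distrib, ← Finset.mul_sum, Finset.sum_boole] at h2
  simp only [Finset.sum_const, nsmul_eq_mul, mul_one] at h2
  zify
  linarith

theorem exists_not_isDown_of_face (f : M.Face) : ∃ d, ¬ M.IsDown d ∧ M.leftFace d = f := by
  by_contra! h
  have h1 : IsEmpty {c : M.Dart // M.leftFace c = f ∧ ¬ M.IsDown c} :=
    ⟨fun c => h c.1 c.2.2 c.2.1⟩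
  have h2 := hM.faceDegree_eq f
  rw [Nat.card_of_isEmpty, mul_zero, faceDegree, Nat.card_eq_zero] at h2
  obtain ⟨d, hd⟩ := M.exists_leftFace f
  rcases h2 with h2 | h2
  · exact h2.false ⟨d, hd⟩
  · exact h2.not_finite inferInstance

theorem exists_faceVertex :
    ∃ e : M.Face ≃ {w : M.mobileOf.Vertex // M.mobileOf.label w = none},
      (∀ d, ¬ M.IsDown d → (e (M.leftFace d)).1 = M.mobileOf.origin d) ∧
      ∀ f, M.faceDegree f = 2 * M.mobileOf.vertexDegree (e f).1 := by
  have hnone : ∀ {x d : M.Dart}, ¬ M.IsDown x → M.mobileOf.origin x = M.mobileOf.origin d →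
      ¬ M.IsDown d := by
    intro x d hx hxd
    rwa [← label_mobileOf_eq_none_iff, ← hxd, label_mobileOf_eq_none_iff]
  obtain ⟨e, he⟩ := exists_equiv_of_quotients (a := M.leftFace) (b := M.mobileOf.origin)
    (P := fun d => ¬ M.IsDown d) (Q := fun _ => True) (R := fun w => M.mobileOf.label w = none)
    (fun x y hx hy => hM.leftFace_eq_iff_of_not_isDown hx hy)
    (fun f => ⟨fun _ => hM.exists_not_isDown_of_face f, fun _ => trivial⟩)
    (fun w => by
      obtain ⟨d, rfl⟩ := M.mobileOf.exists_origin w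
      exact ⟨fun h => ⟨d, (label_mobileOf_eq_none_iff d).1 h, rfl⟩,
        fun ⟨x, hx, hxd⟩ => (label_mobileOf_eq_none_iff d).2 (hnone hx hxd)⟩)
  have he' : ∀ d, ¬ M.IsDown d →
      (((Equiv.subtypeUnivEquiv fun _ => trivial).symm.trans e) (M.leftFace d)).1 =
        M.mobileOf.origin d := fun d hd => he d hd ⟨_, trivial⟩ rfl
  refine ⟨(Equiv.subtypeUnivEquiv fun _ => trivial).symm.trans e, he', fun f => ?_⟩
  obtain ⟨d, hd, rfl⟩ := hM.exists_not_isDown_of_face f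
  rw [hM.faceDegree_eq, he' d hd, vertexDegree]
  congr 1
  refine Nat.card_congr (Equiv.subtypeEquivRight fun c => ?_)
  constructor
  · rintro ⟨h1, h2⟩
    exact (hM.leftFace_eq_iff_of_not_isDown h2 hd).1 h1
  · intro h
    have h2 := hnone hd h.symm
    exact ⟨(hM.leftFace_eq_iff_of_not_isDown h2 hd).2 h, h2⟩

theorem exists_edgeCorner :
    ∃ e : M.Edge ≃ {c : M.mobileOf.Corner // M.mobileOf.label (M.mobileOf.origin c) ≠ none},
      ∀ d, M.IsDown d → (e (M.edge d)).1 = d := by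
  obtain ⟨e, he⟩ := exists_equiv_of_quotients (a := M.edge) (b := (id : M.Dart → M.Dart))
    (P := M.IsDown) (Q := fun _ => True)
    (R := fun c => M.mobileOf.label (M.mobileOf.origin c) ≠ none)
    (fun x y hx hy => by
      rw [edge_eq_iff, sameCycle_iff_of_apply_apply (M.rev_rev x)]
      constructor
      · rintro (rfl | rfl)
        · rfl
        · exact absurd hx ((hM.isDown_rev x).1 hy)
      · rintro (rfl : x = y)
        exact Or.inl rfl)
    (fun u => ⟨fun _ => by
      obtain ⟨d, rfl⟩ := M.exists_edge u
      by_cases hd : M.IsDown d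
      · exact ⟨d, hd, rfl⟩
      · exact ⟨_, (hM.isDown_rev d).2 hd, edge_rev d⟩, fun _ => trivial⟩)
    (fun c => by
      rw [Ne, label_mobileOf_eq_none_iff, not_not]
      exact ⟨fun h => ⟨c, h, rfl⟩, fun ⟨x, hx, hxc⟩ => hxc ▸ hx⟩)
  exact ⟨(Equiv.subtypeUnivEquiv fun _ => trivial).symm.trans e,
    fun d hd => he d hd ⟨_, trivial⟩ rfl⟩

theorem card_vertex_add_card_face_mobileOf :
    Nat.card M.mobileOf.Vertex + Nat.card M.mobileOf.Face =
      Nat.card M.Vertex + Nat.card M.Face := by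
  classical
  obtain ⟨e1, _⟩ := hM.exists_minFace
  obtain ⟨e2, _⟩ := hM.exists_nonMinVertex
  obtain ⟨e3, _⟩ := hM.exists_faceVertex
  have h1 := Nat.card_congr (Equiv.sumCompl M.IsLocalMin)
  have h2 := Nat.card_congr (Equiv.sumCompl fun w => M.mobileOf.label w = none)
  rw [Nat.card_sum] at h1 h2
  have h3 := Nat.card_congr e1
  have h4 := Nat.card_congr e2
  have h5 := Nat.card_congr e3
  simp only [ne_eq] at h4
  omega

/-- For connectedness, compare invariant sets of darts. Invariance under `rot` and `rev` gives
invariance under `faceRot` and under first returns. Conversely, invariance in the mobile covers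
`turn`, hence up darts by the successor rule, then down darts by `invariant_of_hit`. -/
theorem isPlanar_mobileOf_iff : M.mobileOf.IsPlanar ↔ M.IsPlanar := by
  unfold IsPlanar
  rw [hM.card_vertex_add_card_face_mobileOf, isPretransitive_iff, isPretransitive_iff]
  refine and_congr Iff.rfl (and_congr ?_ Iff.rfl)
  constructor
  · intro h S h1 h2
    have hface : ∀ d, S (M.faceRot d) = S d := fun d => by
      rw [← h1, rot_faceRot, h2]
    refine h S (fun d => ?_) h2
    by_cases hd : M.IsDown d
    · exact ((hM.hit_rot hd).sameCycle.invariant h1).symm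
    · exact ((hM.hit_faceRot hd).sameCycle.invariant hface).symm
  · intro h S h1 h2
    refine h S (invariant_of_hit (fun d hd => hM.hit_rot hd) (fun d hd => ?_) fun d _ => h1 d) h2
    have hturn : ∀ x, S (hM.mobileRotation.turn x) = S x := by
      intro x
      have hf : ∀ x, S (M.mobileOf.faceRot x) = S x := fun x => by
        rw [← h1, rot_faceRot]; exact h2 x
      exact (hf _).trans (hf x)
    rcases MobileRotation.chord_cases (B := hM.mobileRotation) (fun _ h => hM.chordAt h) hd with
      ⟨_, h3⟩ | ⟨x, h3, _, _, h4⟩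
    · rw [h3]
      exact (h1 _).trans ((hturn _).trans (h2 d))
    · rw [h4]
      exact (h2 x).trans ((h3.sameCycle.invariant hturn).symm.trans (h2 d))

end HasUnitSteps

theorem isMobile_mobileOf {M : LabeledMap ℤ} (h : M.IsSuitablyLabeled) : M.mobileOf.IsMobile := by
  have hM : M.HasUnitSteps := h.2
  refine ⟨hM.isPlanar_mobileOf_iff.2 h.1, fun d => ?_, fun d hd l l' hl hl' => ?_⟩
  · exact (label_mobileOf_eq_none_iff d).trans
      ((hM.isDown_rev d).symm.trans ((label_mobileOf_eq_none_iff (M.rev d)).not.trans not_not).symm)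
  · replace hd := (label_mobileOf_eq_none_iff d).1 hd
    have h1 : M.IsDown (M.rev d) := (hM.isDown_rev d).2 hd
    have h2 : M.IsDown (M.rev (M.mobileRot⁻¹ d)) :=
      (hM.isDown_rev _).2 ((isDown_mobileRot_inv d).not.2 hd)
    have h3 := hM.label_rev_mobileRot_inv hd
    have e1 := (label_mobileOf_of_isDown h1).symm.trans hl
    have e2 := (label_mobileOf_of_isDown h2).symm.trans hl'
    rw [Option.some.injEq] at e1 e2
    omega

end LabeledMap

/-! ### Isomorphism classes and injectivity -/

namespace LabeledMap

open CombMap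

section Iso

variable {L : Type} {M N : LabeledMap L}

theorem faceRot_of_rot_rev {C C' : CombMap} {e : C.Dart → C'.Dart}
    (h1 : ∀ d, e (C.rot d) = C'.rot (e d)) (h2 : ∀ d, e (C.rev d) = C'.rev (e d)) (d : C.Dart) :
    e (C.faceRot d) = C'.faceRot (e d) := by
  rw [eq_comm, faceRot_eq_iff, ← h1, rot_faceRot, h2]

theorem Iso.card_face_eq (h : M.Iso N) : Nat.card M.Face = Nat.card N.Face := by
  obtain ⟨e, h1, h2, _⟩ := h
  exact Nat.card_congr (Quotient.congr e fun _ _ =>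
    sameCycle_map_iff e (faceRot_of_rot_rev h1 h2))

theorem Iso.isPlanar (h : M.Iso N) (hM : M.IsPlanar) : N.IsPlanar := by
  have hf := h.card_face_eq
  obtain ⟨e, h1, h2, _⟩ := h
  obtain ⟨⟨d⟩, h4, h5⟩ := hM
  refine ⟨⟨e d⟩, ?_, ?_⟩
  · rw [isPretransitive_iff] at h4 ⊢
    intro S k1 k2 x y hx
    have := h4 (fun d => S (e d)) (fun d => by rw [h1, k1]) (fun d => by rw [h2, k2])
      (e.symm x) (e.symm y) (by simpa using hx)
    simpa using this
  · have hv : Nat.card M.Vertex = Nat.card N.Vertex :=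
      Nat.card_congr (Quotient.congr e fun _ _ => sameCycle_map_iff e h1)
    have he : Nat.card M.Edge = Nat.card N.Edge :=
      Nat.card_congr (Quotient.congr e fun _ _ => sameCycle_map_iff e h2)
    omega

theorem Iso.isMobile {B B' : LabeledMap (Option ℤ)} (h : B.Iso B') (hB : B.IsMobile) :
    B'.IsMobile := by
  refine ⟨h.isPlanar hB.1, ?_⟩
  obtain ⟨e, h1, h2, h3⟩ := h
  obtain ⟨-, h4, h5⟩ := hB
  have h1' : ∀ d, e (B.rot⁻¹ d) = B'.rot⁻¹ (e d) := by
    intro d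
    rw [← B'.rot.injective.eq_iff, ← h1]
    simp
  refine ⟨fun d => ?_, fun d hd l l' hl hl' => ?_⟩ <;> obtain ⟨d, rfl⟩ := e.surjective d
  · rw [h3, ← h2, h3]
    exact h4 d
  · rw [h3] at hd
    rw [← h2, h3] at hl
    rw [← h1', ← h2, h3] at hl'
    exact h5 d hd l l' hl hl'

/-- A relation that matches isomorphism classes induces a bijection between them. -/
theorem exists_isoClass_equiv {L L' : Type} {P : LabeledMap L → Prop} {Q : LabeledMap L' → Prop}
    {R : LabeledMap L → LabeledMap L' → Prop} (h1 : ∀ M, P M → ∃ N, Q N ∧ R M N)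
    (h2 : ∀ N, Q N → ∃ M, P M ∧ R M N)
    (h3 : ∀ M M' N N', P M → P M' → R M N → R M' N' → (M.Iso M' ↔ N.Iso N'))
    (h4 : ∀ M N N', R M N → N.Iso N' → R M N') :
    ∃ e : IsoClass P ≃ IsoClass Q, ∀ M hM N hN,
      e (isoClass P M hM) = isoClass Q N hN ↔ R M N := by
  have hP : ∀ {M hM M' hM'}, isoClass P M hM = isoClass P M' hM' ↔ M.Iso M' := Quotient.eq
  have hQ : ∀ {M hM M' hM'}, isoClass Q M hM = isoClass Q M' hM' ↔ M.Iso M' := Quotient.eq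
  -- The related pairs project onto both sets of classes, and `h3` says that both projections
  -- identify the same pairs.
  obtain ⟨e, he⟩ := exists_equiv_of_quotients (D := {M // P M} × {N // Q N})
    (a := fun x => isoClass P x.1.1 x.1.2) (b := fun x => isoClass Q x.2.1 x.2.2)
    (P := fun x => R x.1.1 x.2.1) (Q := fun _ => True) (R := fun _ => True)
    (fun x y hx hy => hP.trans ((h3 _ _ _ _ x.1.2 y.1.2 hx hy).trans hQ.symm))
    (fun u => ⟨fun _ => by
      obtain ⟨⟨M, hM⟩, rfl⟩ := Quotient.exists_rep u
      obtain ⟨N, hN, h⟩ := h1 M hM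
      exact ⟨⟨⟨M, hM⟩, ⟨N, hN⟩⟩, h, rfl⟩, fun _ => trivial⟩)
    (fun u => ⟨fun _ => by
      obtain ⟨⟨N, hN⟩, rfl⟩ := Quotient.exists_rep u
      obtain ⟨M, hM, h⟩ := h2 N hN
      exact ⟨⟨⟨M, hM⟩, ⟨N, hN⟩⟩, h, rfl⟩, fun _ => trivial⟩)
  have he' : ∀ M hM N hN, R M N → e ⟨isoClass P M hM, trivial⟩ = ⟨isoClass Q N hN, trivial⟩ :=
    fun M hM N hN h => Subtype.ext (he ⟨⟨M, hM⟩, ⟨N, hN⟩⟩ h _ rfl)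
  refine ⟨(Equiv.subtypeUnivEquiv fun _ => trivial).symm.trans
    (e.trans (Equiv.subtypeUnivEquiv fun _ => trivial)), fun M hM N hN => ?_⟩
  change (e ⟨isoClass P M hM, trivial⟩).1 = _ ↔ _
  constructor
  · intro h
    obtain ⟨N', hN', h'⟩ := h1 M hM
    rw [he' M hM N' hN' h'] at h
    exact h4 _ _ _ h' (hQ.1 h)
  · intro h
    rw [he' M hM N hN h]

end Iso

section MobileIso

variable {M N : LabeledMap ℤ}

theorem Iso.mobileOf (hM : M.HasUnitSteps) (hN : N.HasUnitSteps) (h : M.Iso N) :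
    M.mobileOf.Iso N.mobileOf := by
  obtain ⟨e, h1, h2, h3⟩ := h
  have hd : ∀ d, N.IsDown (e d) ↔ M.IsDown d := fun d => by
    unfold IsDown
    rw [← h2, h3, h3]
  refine ⟨e, fun d => ?_, h2, fun d => ?_⟩
  · change e (M.mobileRot d) = N.mobileRot (e d)
    by_cases h : M.IsDown d
    · exact ((hM.hit_rot h).map e h1 hd).unique (hN.hit_rot ((hd d).2 h))
    · exact ((hM.hit_faceRot h).map e (faceRot_of_rot_rev h1 h2) (fun d => not_congr (hd d))).unique
        (hN.hit_faceRot ((hd d).not.2 h))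
  · change N.mobileDartLabel (e d) = M.mobileDartLabel d
    by_cases h : M.IsDown d
    · exact (if_pos ((hd d).2 h)).trans ((congrArg some (h3 d)).trans (if_pos h).symm)
    · exact (if_neg ((hd d).not.2 h)).trans (if_neg h).symm

/-- The mobile retains the darts and the labels of upper endpoints; lower endpoints are one less.
The rotation is then recovered from the successor rule. -/
theorem Iso.of_mobileOf (hM : M.HasUnitSteps) (hN : N.HasUnitSteps)
    (h : M.mobileOf.Iso N.mobileOf) : M.Iso N := by
  obtain ⟨(e : M.Dart ≃ N.Dart), (h1 : ∀ d, e (M.mobileRot d) = N.mobileRot (e d)),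
    (h2 : ∀ d, e (M.rev d) = N.rev (e d)),
    (h3 : ∀ d, N.mobileOf.label (N.mobileOf.origin (e d)) =
      M.mobileOf.label (M.mobileOf.origin d))⟩ := h
  have hd : ∀ d, N.IsDown (e d) ↔ M.IsDown d := fun d => by
    rw [← not_iff_not, ← label_mobileOf_eq_none_iff, ← label_mobileOf_eq_none_iff, h3]
  have hdown : ∀ d, M.IsDown d → N.label (N.origin (e d)) = M.label (M.origin d) := by
    intro d h
    have := h3 d
    rw [label_mobileOf_of_isDown h, label_mobileOf_of_isDown ((hd d).2 h)] at this
    exact Option.some.inj this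
  have hlab : ∀ d, N.label (N.origin (e d)) = M.label (M.origin d) := by
    intro d
    by_cases h : M.IsDown d
    · exact hdown d h
    · have h4 := hdown _ ((hM.isDown_rev d).2 h)
      have h5 := hM.label_of_not_isDown h
      have h6 := hN.label_of_not_isDown ((hd d).not.2 h)
      rw [h2] at h4
      omega
  have hturn : ∀ d, e (hM.mobileRotation.turn d) = hN.mobileRotation.turn (e d) := by
    intro d
    symm
    rw [MobileRotation.turn_eq_iff]
    have h4 := MobileRotation.turn_eq_iff.1 (rfl : hM.mobileRotation.turn d = _)
    have h5 := congrArg e h4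
    exact ((h1 _).trans (congrArg N.mobileRot ((h2 _).trans (congrArg N.rev (h1 _))))).symm.trans
      (h5.trans (h2 d))
  -- The rotation of `N` transported by `e` obeys the same rule on up darts and has the same first
  -- returns to down darts.
  have key : M.rot = (e.trans N.rot).trans e.symm := by
    refine perm_eq_of_hit (P := M.IsDown) (q := M.mobileRot) (fun x hx => ?_)
      (fun x hx => hM.hit_rot hx) (fun x hx => ?_)
    · change M.rot x = e.symm (N.rot (e x))
      rw [Equiv.eq_symm_apply]
      obtain ⟨k1, k2⟩ := hN.chordAt ((hN.isDown_rev _).2 ((hd x).not.2 hx))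
      rw [show hN.mobileRotation.rev (N.rev (e x)) = e x from N.rev_rev _, ← h2, ← hturn] at k1
      rw [show hN.mobileRotation.rev (N.rev (e x)) = e x from N.rev_rev _, ← h2] at k2
      rcases MobileRotation.chord_cases (B := hM.mobileRotation) (fun _ h => hM.chordAt h) hx with
        ⟨h4, h5⟩ | ⟨y, h4, h5, _, h6⟩
      · rw [h5]
        refine (h1 _).trans (k1 ?_).symm
        change N.label (N.origin (e (hM.mobileRotation.turn (M.rev x)))) <
          N.label (N.origin (e (M.rev x)))
        rw [hlab, hlab]
        change M.label (M.origin (hM.mobileRotation.turn (M.rev x))) =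
          M.label (M.origin (M.rev x)) - 1 at h4
        omega
      · rw [h6]
        refine (h2 _).trans (k2 (e y) ?_ ?_).symm
        · refine h4.map e hturn fun z => ?_
          change N.label (N.origin (e z)) ≤ N.label (N.origin (e (M.rev x))) ↔
            M.label (M.origin z) ≤ M.label (M.origin (M.rev x))
          rw [hlab, hlab]
        · change N.label (N.origin (e y)) = N.label (N.origin (e (M.rev x)))
          rw [hlab, hlab]
          exact h5
    · have := (hN.hit_rot ((hd x).2 hx)).map (p := N.rot) (q := (e.trans N.rot).trans e.symm)
        (Q := M.IsDown) e.symm (fun z => by simp) (fun z => by rw [← hd]; simp)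
      rwa [← h1, e.symm_apply_apply, e.symm_apply_apply] at this
  refine ⟨e, fun d => ?_, h2, hlab⟩
  rw [key]
  simp

theorem mobileOf_iso_iff (hM : M.HasUnitSteps) (hN : N.HasUnitSteps) :
    M.mobileOf.Iso N.mobileOf ↔ M.Iso N :=
  ⟨Iso.of_mobileOf hM hN, Iso.mobileOf hM hN⟩

end MobileIso

/-! ### The inverse construction and surjectivity -/

section Inverse

/-- The label of the origin of a mobile dart, an unlabeled vertex being given the label `0`. -/
def dartLabel (B : LabeledMap (Option ℤ)) (d : B.Dart) : ℤ := (B.label (B.origin d)).getD 0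

theorem label_eq_some_dartLabel {B : LabeledMap (Option ℤ)} {d : B.Dart}
    (h : B.label (B.origin d) ≠ none) : B.label (B.origin d) = some (B.dartLabel d) := by
  obtain ⟨l, hl⟩ := Option.ne_none_iff_exists'.1 h
  rw [dartLabel, hl]
  rfl

variable {B : LabeledMap (Option ℤ)} (hB : B.IsMobile)

theorem _root_.CombMap.origin_rot_inv {C : CombMap} (d : C.Dart) :
    C.origin (C.rot⁻¹ d) = C.origin d := by
  rw [← origin_rot]; simp

/-- A mobile as a rotation system. -/
def IsMobile.mobileRotation : MobileRotation B.Dart where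
  rot := B.rot
  rev := B.rev
  down d := B.label (B.origin d) ≠ none
  lab := B.dartLabel
  rev_rev := B.rev_rev
  down_rev d := (hB.2.1 d).symm.trans not_not.symm
  down_rot d := by rw [origin_rot]
  lab_rot c _ := by rw [dartLabel, origin_rot, dartLabel]
  lab_turn c hc := by
    have h1 : B.label (B.origin (B.rev c)) = none := (hB.2.1 _).2 (by rwa [B.rev_rev])
    have h2 : B.label (B.origin (B.rev (B.rot⁻¹ (B.rev c)))) ≠ none :=
      (hB.2.1 _).1 (by rwa [origin_rot_inv])
    have := hB.2.2 _ h1 (B.dartLabel c) (B.dartLabel (B.rev (B.rot⁻¹ (B.rev c))))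
      (by rw [B.rev_rev]; exact label_eq_some_dartLabel hc) (label_eq_some_dartLabel h2)
    rw [dartLabel, dartLabel, origin_rot_inv]
    exact this

end Inverse

end LabeledMap

namespace MobileRotation

open CombMap

variable {D : Type} {B : MobileRotation D}

open Classical in
/-- The label in the suitably labeled map of the origin of a mobile dart. -/
noncomputable def mapLabel (B : MobileRotation D) (d : D) : ℤ :=
  if B.down d then B.lab d else B.lab (B.rev d) - 1

theorem mapLabel_of_down {d : D} (h : B.down d) : B.mapLabel d = B.lab d := if_pos h

theorem mapLabel_rev_of_down {d : D} (h : B.down d) : B.mapLabel (B.rev d) = B.lab d - 1 := by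
  rw [mapLabel, if_neg fun h' => (B.down_rev d).1 h' h, B.rev_rev]

variable [Finite D] {r : Equiv.Perm D}
  (hr : ∀ c, B.down c → B.ChordAt r c) (hB : ∀ c, B.down c → Hit r B.down c (B.rot c))

include hr hB in
-- Consecutive up darts come from corners of equal label, and a transition from an up dart to a down
-- dart is a contour step of exactly `-1`; first returns to down darts stay at one labeled vertex of
-- the mobile.
theorem mapLabel_apply (d : D) : B.mapLabel (r d) = B.mapLabel d := by
  refine invariant_of_hit (f := B.mapLabel) hB (fun u hu => ?_) (fun c hc => ?_) d
  · have hu' := (B.down_rev u).2 hu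
    rcases chord_cases hr hu with ⟨h1, h2⟩ | ⟨x, _, h2, h3, h4⟩
    · have hd : B.down (B.turn (B.rev u)) := (down_turn _).2 hu'
      rw [h2, mapLabel, mapLabel, if_pos ((B.down_rot _).2 hd), if_neg hu, B.lab_rot _ hd, h1]
    · rw [h4, mapLabel, mapLabel, if_neg hu, if_neg fun h => (B.down_rev x).1 h h3, B.rev_rev, h2]
  · rw [mapLabel, mapLabel, if_pos hc, if_pos ((B.down_rot _).2 hc), B.lab_rot _ hc]

/-- The labeled map whose mobile is given: its edges join each labeled corner to its successor. -/
noncomputable def toLabeledMap : LabeledMap ℤ where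
  Dart := D
  finite_dart := inferInstance
  rot := r
  rev := B.rev
  rev_rev := B.rev_rev
  rev_ne d h := by
    have := B.down_rev d
    rw [h] at this
    tauto
  label := Quotient.lift B.mapLabel
    (fun _ _ h => Equiv.Perm.SameCycle.invariant (mapLabel_apply hr hB) h)

theorem isDown_toLabeledMap (d : D) : (toLabeledMap hr hB).IsDown d ↔ B.down d := by
  change B.mapLabel (B.rev d) < B.mapLabel d ↔ _
  by_cases h : B.down d
  · rw [mapLabel_of_down h, mapLabel_rev_of_down h]
    exact iff_of_true (by omega) h
  · have h' := (B.down_rev d).2 h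
    have h1 := mapLabel_rev_of_down h'
    rw [B.rev_rev] at h1
    rw [mapLabel_of_down h', h1]
    exact iff_of_false (by omega) h

theorem hasUnitSteps_toLabeledMap : (toLabeledMap hr hB).HasUnitSteps := by
  intro (d : D)
  change |B.mapLabel (B.rev d) - B.mapLabel d| = 1
  by_cases h : B.down d
  · rw [mapLabel_of_down h, mapLabel_rev_of_down h]
    simp
  · have h' := (B.down_rev d).2 h
    have h1 := mapLabel_rev_of_down h'
    rw [B.rev_rev] at h1
    rw [mapLabel_of_down h', h1]
    simp

theorem mobileRot_toLabeledMap (d : D) : (toLabeledMap hr hB).mobileRot d = B.rot d := by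
  have hM := hasUnitSteps_toLabeledMap hr hB
  have hd := isDown_toLabeledMap hr hB
  by_cases h : B.down d
  · exact ((hM.hit_rot ((hd d).2 h)).congr_pred hd).unique (hB d h)
  · exact ((hM.hit_faceRot ((hd d).not.2 h)).congr_pred fun d => not_congr (hd d)).unique
      (hit_faceRot hr hB h)

end MobileRotation

namespace LabeledMap

open CombMap

theorem exists_iso_mobileOf {B : LabeledMap (Option ℤ)} (hB : B.IsMobile) :
    ∃ M : LabeledMap ℤ, M.IsSuitablyLabeled ∧ M.mobileOf.Iso B := by
  obtain ⟨r, hr, hrot⟩ := hB.mobileRotation.exists_chordRot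
  have hM := MobileRotation.hasUnitSteps_toLabeledMap hr hrot
  have hiso : (MobileRotation.toLabeledMap hr hrot).mobileOf.Iso B := by
    refine ⟨Equiv.refl _, fun d => MobileRotation.mobileRot_toLabeledMap hr hrot d,
      fun d => rfl, fun d => ?_⟩
    change B.label (B.origin d) = _
    by_cases h : B.label (B.origin d) = none
    · rw [h, eq_comm]
      refine label_mobileOf_of_not_isDown (M := MobileRotation.toLabeledMap hr hrot) ?_
      exact fun h' => (MobileRotation.isDown_toLabeledMap hr hrot d).1 h' h
    · refine Eq.trans ?_ (label_mobileOf_of_isDown (M := MobileRotation.toLabeledMap hr hrot)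
        ((MobileRotation.isDown_toLabeledMap hr hrot d).2 h)).symm
      exact (label_eq_some_dartLabel h).trans (congrArg some
        (MobileRotation.mapLabel_of_down (B := hB.mobileRotation) h).symm)
  exact ⟨_, ⟨hM.isPlanar_mobileOf_iff.1 (hiso.symm.isPlanar hB.1), hM⟩, hiso⟩

theorem exists_mobile_equiv :
    ∃ F : IsoClass IsSuitablyLabeled ≃ IsoClass IsMobile,
      ∀ (M : LabeledMap ℤ) (hM : M.IsSuitablyLabeled), ∃ hB : M.mobileOf.IsMobile,
        F (isoClass _ M hM) = isoClass _ M.mobileOf hB := by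
  obtain ⟨e, he⟩ := exists_isoClass_equiv (P := IsSuitablyLabeled) (Q := IsMobile)
    (R := fun M B => M.mobileOf.Iso B)
    (fun M hM => ⟨M.mobileOf, isMobile_mobileOf hM, Iso.refl _⟩)
    (fun B hB => exists_iso_mobileOf hB)
    (fun M M' B B' hM hM' h h' => (mobileOf_iso_iff hM.2 hM'.2).symm.trans
      ⟨fun k => (h.symm.trans k).trans h', fun k => (h.trans k).trans h'.symm⟩)
    (fun M B B' h k => h.trans k)
  exact ⟨e, fun M hM => ⟨isMobile_mobileOf hM, (he _ _ _ _).2 (Iso.refl _)⟩⟩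

end LabeledMap

/-! ### Quadrangulations and well-labeled maps -/

namespace LabeledMap

open CombMap

section Subdivide

variable {W W' : LabeledMap ℤ}

theorem label_subdivide_inl (d : W.Dart) :
    W.subdivide.label (W.subdivide.origin (Sum.inl d)) = some (W.label (W.origin d)) := rfl

theorem faceRot_subdivide_inl (d : W.Dart) :
    W.subdivide.faceRot (Sum.inl d) = Sum.inr (W.rev d) := by
  refine faceRot_eq_iff.2 ?_
  exact congrArg Sum.inr (W.rev_rev d)

theorem faceRot_subdivide_inr (d : W.Dart) :
    W.subdivide.faceRot (Sum.inr (W.rev d)) = Sum.inl (W.faceRot d) := by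
  refine faceRot_eq_iff.2 ?_
  exact congrArg Sum.inl (rot_faceRot d)

theorem card_vertex_subdivide :
    Nat.card W.subdivide.Vertex = Nat.card W.Vertex + Nat.card W.Edge := by
  rw [← Nat.card_sum]
  let f : W.Dart ⊕ W.Dart → W.Vertex ⊕ W.Edge := Sum.map W.origin W.edge
  have hf : ∀ x, f (W.subdivide.rot x) = f x := by
    rintro (d | d)
    · exact congrArg Sum.inl (origin_rot d)
    · exact congrArg Sum.inr (edge_rev d)
  refine Nat.card_congr (Equiv.ofBijective
    (Quotient.lift f fun _ _ h => Equiv.Perm.SameCycle.invariant hf h) ⟨?_, ?_⟩)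
  · intro v w
    induction v using Quotient.inductionOn with | _ x =>
    induction w using Quotient.inductionOn with | _ y =>
    intro (h : f x = f y)
    refine Quotient.sound ?_
    obtain x | x := x <;> obtain y | y := y
    · exact sameCycle_map (p := W.rot) (e := Sum.inl) (fun _ => rfl)
        (origin_eq_iff.1 (Sum.inl_injective h))
    · cases h
    · cases h
    · exact sameCycle_map (p := W.rev) (e := Sum.inr) (fun _ => rfl)
        (edge_eq_iff.1 (Sum.inr_injective h))
  · rintro (v | e)
    · obtain ⟨d, rfl⟩ := W.exists_origin v
      exact ⟨W.subdivide.origin (Sum.inl d), rfl⟩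
    · obtain ⟨d, rfl⟩ := W.exists_edge e
      exact ⟨W.subdivide.origin (Sum.inr d), rfl⟩

theorem card_face_subdivide : Nat.card W.subdivide.Face = Nat.card W.Face := by
  let f : W.Dart ⊕ W.Dart → W.Face := Sum.elim W.leftFace fun d => W.leftFace (W.rev d)
  have hf : ∀ x, f (W.subdivide.faceRot x) = f x := by
    rintro (d | d)
    · rw [faceRot_subdivide_inl]
      exact congrArg W.leftFace (W.rev_rev d)
    · obtain ⟨d, rfl⟩ := W.rev.surjective d
      rw [faceRot_subdivide_inr]
      exact (leftFace_faceRot d).trans (congrArg W.leftFace (W.rev_rev d).symm)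
  refine Nat.card_congr (Equiv.ofBijective
    (Quotient.lift f fun _ _ h => Equiv.Perm.SameCycle.invariant hf h) ⟨?_, ?_⟩)
  · have hrep : ∀ u : W.subdivide.Face, ∃ d : W.Dart, W.subdivide.leftFace (Sum.inl d) = u := by
      intro u
      obtain ⟨d | d, rfl⟩ := W.subdivide.exists_leftFace u
      · exact ⟨d, rfl⟩
      · obtain ⟨d, rfl⟩ := W.rev.surjective d
        refine ⟨W.faceRot d, ?_⟩
        rw [← faceRot_subdivide_inr]
        exact leftFace_faceRot (C := W.subdivide.toCombMap) _
    intro u v h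
    obtain ⟨x, rfl⟩ := hrep u
    obtain ⟨y, rfl⟩ := hrep v
    have h1 : W.faceRot.SameCycle x y := leftFace_eq_iff.1 h
    refine (leftFace_eq_iff (C := W.subdivide.toCombMap)).2 ?_
    -- One step along a face of `W` is two steps along the subdivided face.
    refine Equiv.Perm.SameCycle.of_pow (n := 2)
      (sameCycle_map (e := Sum.inl) (fun d => ?_) h1)
    rw [pow_two]
    exact (faceRot_subdivide_inr d).symm.trans
      (congrArg W.subdivide.faceRot (faceRot_subdivide_inl d).symm)
  · intro u
    obtain ⟨d, rfl⟩ := W.exists_leftFace u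
    exact ⟨W.subdivide.leftFace (Sum.inl d), rfl⟩

theorem card_edge_subdivide : Nat.card W.subdivide.Edge = 2 * Nat.card W.Edge := by
  have h1 := W.subdivide.toCombMap.card_dart
  have h2 : Nat.card W.subdivide.Dart = Nat.card W.Dart + Nat.card W.Dart := Nat.card_sum
  have h3 := W.toCombMap.card_dart
  omega

theorem isPlanar_subdivide_iff : W.subdivide.IsPlanar ↔ W.IsPlanar := by
  unfold IsPlanar
  rw [card_vertex_subdivide, card_face_subdivide, card_edge_subdivide, isPretransitive_iff,
    isPretransitive_iff]
  refine and_congr ?_ (and_congr ?_ (by omega))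
  · exact ⟨fun ⟨d⟩ => ⟨Sum.elim id id d⟩, fun ⟨d⟩ => ⟨Sum.inl d⟩⟩
  · constructor
    · intro h S h1 h2 x y hx
      refine h (Sum.elim S S) ?_ ?_ (Sum.inl x) (Sum.inl y) hx
      · rintro (d | d)
        · exact h1 d
        · exact h2 d
      · rintro (d | d) <;> rfl
    · intro h S h1 h2 x y hx
      have hinr : ∀ d : W.Dart, S (Sum.inr d) = S (Sum.inl d) := fun d => h2 (Sum.inl d)
      have key := h (fun d => S (Sum.inl d)) (fun d => h1 (Sum.inl d)) (fun d => by
        rw [← hinr, ← hinr]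
        exact h1 (Sum.inr d))
      obtain x | x := x <;> obtain y | y := y
      · exact key _ _ hx
      · exact (hinr y).mpr (key _ _ hx)
      · exact key _ _ ((hinr x).mp hx)
      · exact (hinr y).mpr (key _ _ ((hinr x).mp hx))

/-- The middle of an edge has just two neighbors, each clockwise next to the other, so the mobile
inequality holds in both directions and bounds the difference by one. -/
theorem isMobile_subdivide_iff : W.subdivide.IsMobile ↔ W.IsWellLabeled := by
  have hrot : ∀ d : W.Dart, W.subdivide.rot⁻¹ (Sum.inr d) = Sum.inr (W.rev d) := by
    intro d
    exact Equiv.Perm.inv_eq_iff_eq.2 (congrArg Sum.inr (W.rev_rev d).symm)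
  unfold IsMobile IsWellLabeled
  rw [isPlanar_subdivide_iff]
  refine and_congr Iff.rfl ⟨fun h d => ?_, fun h => ⟨?_, ?_⟩⟩
  · have key : ∀ d : W.Dart, W.label (W.origin d) - 1 ≤ W.label (W.origin (W.rev d)) := by
      intro d
      refine h.2 (Sum.inr d) rfl _ _ rfl ?_
      rw [hrot]
      rfl
    have h1 := key d
    have h2 := key (W.rev d)
    rw [W.rev_rev] at h2
    rw [abs_le]
    omega
  · rintro (d | d)
    · exact iff_of_false (by rw [label_subdivide_inl]; simp) (fun h => h rfl)
    · exact iff_of_true rfl fun h => by cases h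
  · rintro (d | d) hd l l' hl hl'
    · cases hd
    · rw [hrot] at hl'
      have h1 := Option.some.inj hl
      have h2 := Option.some.inj hl'
      have h3 := abs_le.1 (h d)
      rw [h1, h2] at h3
      omega

/-- The unlabeled vertices have degree two. -/
def UnlabeledBivalent (B : LabeledMap (Option ℤ)) : Prop :=
  ∀ d, B.label (B.origin d) = none → B.rot d ≠ d ∧ B.rot (B.rot d) = d

theorem unlabeledBivalent_subdivide : W.subdivide.UnlabeledBivalent := by
  rintro (d | d) hd
  · cases hd
  · exact ⟨fun h => W.rev_ne d (Sum.inr_injective h), congrArg Sum.inr (W.rev_rev d)⟩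

theorem Iso.unlabeledBivalent {B B' : LabeledMap (Option ℤ)} (h : B.Iso B')
    (hB : B.UnlabeledBivalent) : B'.UnlabeledBivalent := by
  obtain ⟨e, h1, h2, h3⟩ := h
  intro d hd
  obtain ⟨d, rfl⟩ := e.surjective d
  rw [h3] at hd
  rw [← h1, ← h1]
  exact ⟨fun h => (hB d hd).1 (e.injective h), congrArg e (hB d hd).2⟩

theorem HasUnitSteps.isQuadrangulation_iff {M : LabeledMap ℤ} (hM : M.HasUnitSteps) :
    M.IsQuadrangulation ↔ M.mobileOf.UnlabeledBivalent := by
  obtain ⟨e, _, he⟩ := hM.exists_faceVertex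
  have h4 : ∀ f, M.faceDegree f = 4 ↔ M.mobileOf.vertexDegree (e f).1 = 2 := fun f => by
    rw [he]; omega
  constructor
  · intro h d hd
    refine vertexDegree_origin_eq_two_iff.1 ?_
    have := (h4 (e.symm ⟨_, hd⟩)).1 (h _)
    rwa [e.apply_symm_apply] at this
  · intro h f
    rw [h4]
    obtain ⟨⟨w, hw⟩, h1⟩ : ∃ w, e f = w := ⟨_, rfl⟩
    rw [h1]
    obtain ⟨d, rfl⟩ := M.mobileOf.exists_origin w
    exact vertexDegree_origin_eq_two_iff.2 (h d hw)

/-- Erasing the unlabeled vertices of a mobile in which they all have degree two. -/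
theorem exists_iso_subdivide {B : LabeledMap (Option ℤ)} (hB : B.IsMobile)
    (h2 : B.UnlabeledBivalent) : ∃ W : LabeledMap ℤ, W.subdivide.Iso B := by
  have hnone : ∀ {c}, B.label (B.origin c) ≠ none → B.label (B.origin (B.rev c)) = none :=
    fun {c} hc => (hB.2.1 _).2 (by rwa [B.rev_rev])
  -- Cross the bivalent vertex: go to the middle, switch to its other dart, and take the far end of
  -- that dart.
  let flip : {c // B.label (B.origin c) ≠ none} → {c // B.label (B.origin c) ≠ none} :=
    fun c => ⟨B.rev (B.rot (B.rev c.1)), (hB.2.1 _).1 (by rw [origin_rot]; exact hnone c.2)⟩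
  have hflip : Function.Involutive flip := fun c => Subtype.ext (by
    change B.rev (B.rot (B.rev (B.rev (B.rot (B.rev c.1))))) = c.1
    rw [B.rev_rev, (h2 _ (hnone c.2)).2, B.rev_rev])
  let r : Equiv.Perm {c // B.label (B.origin c) ≠ none} :=
    B.rot.subtypePerm fun c => by rw [origin_rot]
  have hr : ∀ c, B.dartLabel (r c).1 = B.dartLabel c.1 := fun c => by
    change B.dartLabel (B.rot c.1) = _
    rw [dartLabel, origin_rot, dartLabel]
  let W : LabeledMap ℤ :=
    { Dart := {c // B.label (B.origin c) ≠ none}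
      finite_dart := inferInstance
      rot := r
      rev := hflip.toPerm
      rev_rev := hflip
      rev_ne := fun c h => (h2 _ (hnone c.2)).1 (by
        have h1 := congrArg (fun x => B.rev x.1) h
        change B.rev (B.rev (B.rot (B.rev c.1))) = B.rev c.1 at h1
        rwa [B.rev_rev] at h1)
      label := Quotient.lift
        (fun c : {c // B.label (B.origin c) ≠ none} => B.dartLabel c.1)
        (fun _ _ h => Equiv.Perm.SameCycle.invariant (p := r) (f := fun c => B.dartLabel c.1)
          hr h) }
  let e : W.Dart ⊕ W.Dart → B.Dart := Sum.elim (fun c => c.1) (fun c => B.rev c.1)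
  have he : Function.Bijective e := by
    constructor
    · rintro (⟨x, hx⟩ | ⟨x, hx⟩) (⟨y, hy⟩ | ⟨y, hy⟩) h
      · exact congrArg Sum.inl (Subtype.ext h)
      · change x = B.rev y at h
        subst h
        exact absurd (hnone hy) hx
      · change B.rev x = y at h
        subst h
        exact absurd (hnone hx) hy
      · exact congrArg Sum.inr (Subtype.ext (B.rev.injective h))
    · intro d
      by_cases hd : B.label (B.origin d) = none
      · exact ⟨Sum.inr ⟨B.rev d, (hB.2.1 d).1 hd⟩, B.rev_rev d⟩
      · exact ⟨Sum.inl ⟨d, hd⟩, rfl⟩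
  refine ⟨W, Equiv.ofBijective e he, ?_, ?_, ?_⟩
  · rintro (c | c)
    · rfl
    · exact B.rev_rev _
  · rintro (c | c)
    · rfl
    · exact (B.rev_rev _).symm
  · rintro (c | c)
    · exact label_eq_some_dartLabel c.2
    · exact hnone c.2

theorem Iso.subdivide (h : W.Iso W') : W.subdivide.Iso W'.subdivide := by
  obtain ⟨e, h1, h2, h3⟩ := h
  refine ⟨Equiv.sumCongr e e, ?_, ?_, ?_⟩
  · rintro (d | d)
    · exact congrArg Sum.inl (h1 d)
    · exact congrArg Sum.inr (h2 d)
  · rintro (d | d) <;> rfl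
  · rintro (d | d)
    · exact congrArg some (h3 d)
    · rfl

theorem Iso.of_subdivide (h : W.subdivide.Iso W'.subdivide) : W.Iso W' := by
  obtain ⟨(e : W.Dart ⊕ W.Dart ≃ W'.Dart ⊕ W'.Dart),
    (h1 : ∀ d, e (Equiv.sumCongr W.rot W.rev d) = Equiv.sumCongr W'.rot W'.rev (e d)),
    (h2 : ∀ d, e d.swap = (e d).swap),
    (h3 : ∀ d, Sum.elim (fun d => some (W'.label (W'.origin d))) (fun _ => none) (e d) =
      Sum.elim (fun d => some (W.label (W.origin d))) (fun _ => none) d)⟩ := h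
  have hinl : ∀ d : W.Dart, ∃ d' : W'.Dart, e (Sum.inl d) = Sum.inl d' := by
    intro d
    have := h3 (Sum.inl d)
    rcases h : e (Sum.inl d) with d' | d'
    · exact ⟨d', rfl⟩
    · rw [h] at this
      cases this
  choose f hf using hinl
  have hinr : ∀ d, e (Sum.inr d) = Sum.inr (f d) := fun d =>
    (h2 (Sum.inl d)).trans (by rw [hf]; rfl)
  have hbij : Function.Bijective f := by
    constructor
    · intro x y h
      exact Sum.inl_injective (e.injective (by rw [hf, hf, h]))
    · intro d'
      obtain ⟨d | d, hd⟩ := e.surjective (Sum.inl d')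
      · exact ⟨d, Sum.inl_injective ((hf d).symm.trans hd)⟩
      · rw [hinr] at hd
        cases hd
  refine ⟨Equiv.ofBijective f hbij, fun d => ?_, fun d => ?_, fun d => ?_⟩
  · refine Sum.inl_injective ((hf _).symm.trans ((h1 (Sum.inl d)).trans ?_))
    rw [hf]
    rfl
  · refine Sum.inr_injective ((hinr _).symm.trans ((h1 (Sum.inr d)).trans ?_))
    rw [hinr]
    rfl
  · have := h3 (Sum.inl d)
    rw [hf] at this
    exact Option.some.inj this

end Subdivide

theorem HasUnitSteps.existsUnique_isLocalMin_iff {M : LabeledMap ℤ} (hM : M.HasUnitSteps) :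
    (∃! v, M.IsLocalMin v) ↔ Nat.card M.mobileOf.Face = 1 := by
  obtain ⟨e, _⟩ := hM.exists_minFace
  rw [← Nat.card_congr e, Nat.card_eq_one_iff_exists]
  constructor
  · rintro ⟨v, hv, h⟩
    exact ⟨⟨v, hv⟩, fun w => Subtype.ext (h _ w.2)⟩
  · rintro ⟨v, h⟩
    exact ⟨v.1, v.2, fun w hw => congrArg Subtype.val (h ⟨w, hw⟩)⟩

theorem exists_quadrangulation_equiv :
    ∃ G : IsoClass (fun M : LabeledMap ℤ => M.IsSuitablyLabeled ∧ M.IsQuadrangulation) ≃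
        IsoClass IsWellLabeled,
      ∀ (M : LabeledMap ℤ) (hM : M.IsSuitablyLabeled ∧ M.IsQuadrangulation)
        (W : LabeledMap ℤ) (hW : W.IsWellLabeled),
        (G (isoClass _ M hM) = isoClass _ W hW ↔ M.mobileOf.Iso W.subdivide) ∧
        (M.mobileOf.Iso W.subdivide → ((∃! v, M.IsLocalMin v) ↔ Nat.card W.Face = 1)) := by
  obtain ⟨e, he⟩ := exists_isoClass_equiv
    (P := fun M : LabeledMap ℤ => M.IsSuitablyLabeled ∧ M.IsQuadrangulation)
    (Q := IsWellLabeled) (R := fun M W => M.mobileOf.Iso W.subdivide)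
    (fun M hM => by
      have hB := isMobile_mobileOf hM.1
      obtain ⟨W, hW⟩ := exists_iso_subdivide hB
        ((HasUnitSteps.isQuadrangulation_iff hM.1.2).1 hM.2)
      exact ⟨W, isMobile_subdivide_iff.1 (hW.symm.isMobile hB), hW.symm⟩)
    (fun W hW => by
      obtain ⟨M, hM, h⟩ := exists_iso_mobileOf (isMobile_subdivide_iff.2 hW)
      exact ⟨M, ⟨hM, (HasUnitSteps.isQuadrangulation_iff hM.2).2
        (h.symm.unlabeledBivalent unlabeledBivalent_subdivide)⟩, h⟩)
    (fun M M' W W' hM hM' h h' => (mobileOf_iso_iff hM.1.2 hM'.1.2).symm.trans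
      ⟨fun k => Iso.of_subdivide ((h.symm.trans k).trans h'),
        fun k => (h.trans k.subdivide).trans h'.symm⟩)
    (fun M W W' h k => h.trans k.subdivide)
  refine ⟨e, fun M hM W hW => ⟨he _ _ _ _, fun h => ?_⟩⟩
  rw [HasUnitSteps.existsUnique_isLocalMin_iff hM.1.2, h.card_face_eq, card_face_subdivide]

end LabeledMap

/-! ### Geodesic labelings -/

namespace CombMap

variable {C : CombMap}

theorem adj_graph_iff {v w : C.Vertex} :
    C.graph.Adj v w ↔ v ≠ w ∧ ∃ d, C.origin d = v ∧ C.origin (C.rev d) = w := by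
  rw [graph, SimpleGraph.fromRel_adj]
  refine and_congr Iff.rfl ⟨?_, Or.inl⟩
  rintro (h | ⟨d, rfl, rfl⟩)
  · exact h
  · exact ⟨C.rev d, rfl, by rw [C.rev_rev]⟩

theorem IsPlanar.reachable (hC : C.IsPlanar) (v w : C.Vertex) : C.graph.Reachable v w := by
  have step : ∀ d, C.graph.Reachable (C.origin d) (C.origin (C.rev d)) := by
    intro d
    by_cases h : C.origin d = C.origin (C.rev d)
    · rw [h]
    · exact (adj_graph_iff.2 ⟨h, d, rfl, rfl⟩ : C.graph.Adj _ _).reachable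
  obtain ⟨x, rfl⟩ := C.exists_origin v
  obtain ⟨y, rfl⟩ := C.exists_origin w
  refine isPretransitive_iff.1 hC.2.1 (fun d => C.graph.Reachable (C.origin x) (C.origin d))
    (fun d => by rw [origin_rot]) (fun d => propext ?_) x y (SimpleGraph.Reachable.refl _)
  exact ⟨fun h => h.trans (step d).symm, fun h => h.trans (step d)⟩

end CombMap

namespace LabeledMap

open CombMap

section Geodesic

variable {M : LabeledMap ℤ}

theorem HasUnitSteps.label_le_of_walk (hM : M.HasUnitSteps) {v w : M.Vertex}
    (p : M.graph.Walk v w) : M.label w ≤ M.label v + p.length := by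
  induction p with
  | nil => simp
  | cons h p ih =>
    obtain ⟨_, d, rfl, rfl⟩ := adj_graph_iff.1 h
    have := (abs_le.1 (hM d).le).2
    rw [SimpleGraph.Walk.length_cons]
    push_cast
    omega

theorem HasUnitSteps.adj (hM : M.HasUnitSteps) (d : M.Dart) :
    M.graph.Adj (M.origin d) (M.origin (M.rev d)) := by
  refine adj_graph_iff.2 ⟨fun h => ?_, d, rfl, rfl⟩
  have := hM d
  rw [h] at this
  simp at this

/-- Going down from any vertex leads to a local min. -/
theorem HasUnitSteps.exists_walk_of_isLocalMin (hM : M.HasUnitSteps) (v : M.Vertex) :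
    ∃ m, M.IsLocalMin m ∧ ∃ p : M.graph.Walk m v, M.label v = M.label m + p.length := by
  obtain ⟨K, hK⟩ := (Set.finite_range M.label).bddBelow
  have hK' : ∀ v, K ≤ M.label v := fun v => hK ⟨v, rfl⟩
  obtain ⟨n, hn⟩ : ∃ n : ℕ, M.label v - K = n :=
    ⟨(M.label v - K).toNat, by have := hK' v; omega⟩
  induction n generalizing v with
  | zero =>
    refine ⟨v, fun d hd => ?_, .nil, by simp⟩
    subst hd
    by_contra h
    have h1 := hM.label_of_isDown (not_not.1 ((hM.isUp_iff d).not.1 h))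
    have := hK' (M.origin (M.rev d))
    omega
  | succ n ih =>
    by_cases hv : M.IsLocalMin v
    · exact ⟨v, hv, .nil, by simp⟩
    · obtain ⟨d, hd, rfl⟩ := (hM.not_isLocalMin_iff v).1 hv
      have h1 := hM.label_of_isDown hd
      obtain ⟨m, hm, p, hp⟩ := ih (M.origin (M.rev d)) (by push_cast at hn; omega)
      refine ⟨m, hm, p.concat (hM.adj d).symm, ?_⟩
      rw [SimpleGraph.Walk.length_concat]
      push_cast
      omega

/-- With a single local min `m`, a descending path from `v` ends at `m` and bounds the distance
above by the label difference; unit steps bound it below. Conversely, every vertex other than `m`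
has a neighbor closer to `m`. -/
theorem IsSuitablyLabeled.unique_isLocalMin_iff (h : M.IsSuitablyLabeled) (m : M.Vertex) :
    (∀ v, M.IsLocalMin v ↔ v = m) ↔ ∀ v, M.label v = M.label m + (M.graph.dist m v : ℤ) := by
  have hM : M.HasUnitSteps := h.2
  constructor
  · intro hm v
    obtain ⟨m', hm', p, hp⟩ := hM.exists_walk_of_isLocalMin v
    obtain rfl := (hm m').1 hm'
    obtain ⟨q, hq⟩ := (h.1.reachable m' v).exists_walk_length_eq_dist
    have h1 := hM.label_le_of_walk q
    have h2 := SimpleGraph.dist_le p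
    omega
  · intro hm v
    constructor
    · intro hv
      by_contra hne
      obtain ⟨q, hq⟩ := (h.1.reachable v m).exists_walk_length_eq_dist
      rw [SimpleGraph.dist_comm] at hq
      cases q with
      | nil => exact hne rfl
      | cons hadj q =>
        obtain ⟨_, d, rfl, rfl⟩ := adj_graph_iff.1 hadj
        have h1 := hv d rfl
        have h2 := SimpleGraph.dist_le q
        rw [SimpleGraph.dist_comm] at h2
        rw [SimpleGraph.Walk.length_cons] at hq
        rw [hm (M.origin d), hm (M.origin (M.rev d))] at h1
        omega
    · rintro rfl d hd
      subst hd
      have h1 := hm (M.origin (M.rev d))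
      have h2 := hM d
      by_contra hlt
      rw [h1] at hlt h2
      -- A neighbor that is not higher would be at distance zero, with the same label, against the
      -- unit step.
      rw [show (M.graph.dist (M.origin d) (M.origin (M.rev d)) : ℤ) = 0 by omega] at h2
      simp at h2

theorem even_length_iff_of_walk {C : CombMap} {s : Set C.Vertex}
    (hs : ∀ d, C.origin d ∈ s ↔ C.origin (C.rev d) ∉ s) {v w : C.Vertex} (p : C.graph.Walk v w) :
    Even p.length ↔ (v ∈ s ↔ w ∈ s) := by
  induction p with
  | nil => simp
  | cons h p ih =>
    obtain ⟨_, d, rfl, rfl⟩ := adj_graph_iff.1 h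
    rw [SimpleGraph.Walk.length_cons, Nat.even_add_one, ih, hs d]
    tauto

/-- Distances to `m` of adjacent vertices differ by at most one, and bipartiteness gives them
opposite parities. -/
theorem isSuitablyLabeled_geodesic {C : CombMap} (hC : C.IsPlanar) (hb : C.IsBipartite)
    (m : C.Vertex) : (geodesic C m).IsSuitablyLabeled := by
  obtain ⟨s, hs⟩ := hb
  refine ⟨hC, fun d => ?_⟩
  change |(C.graph.dist m (C.origin (C.rev d)) : ℤ) - C.graph.dist m (C.origin d)| = 1
  have hne : C.origin d ≠ C.origin (C.rev d) := fun h => by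
    have := hs d
    rw [← h] at this
    tauto
  have hadj : C.graph.Adj (C.origin d) (C.origin (C.rev d)) :=
    adj_graph_iff.2 ⟨hne, d, rfl, rfl⟩
  obtain ⟨p, hp⟩ := (hC.reachable m (C.origin d)).exists_walk_length_eq_dist
  obtain ⟨q, hq⟩ := (hC.reachable m (C.origin (C.rev d))).exists_walk_length_eq_dist
  have h1 := even_length_iff_of_walk hs p
  have h2 := even_length_iff_of_walk hs q
  have h3 := SimpleGraph.dist_le (p.concat hadj)
  have h4 := SimpleGraph.dist_le (q.concat hadj.symm)
  rw [SimpleGraph.Walk.length_concat] at h3 h4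
  rw [hp] at h1 h3
  rw [hq] at h2 h4
  have h5 : C.graph.dist m (C.origin (C.rev d)) ≠ C.graph.dist m (C.origin d) := by
    intro h
    rw [h, h1] at h2
    have := hs d
    tauto
  rcases lt_or_gt_of_ne h5 with h6 | h6
  · rw [abs_of_neg (by omega)]; omega
  · rw [abs_of_pos (by omega)]; omega

end Geodesic

end LabeledMap

theorem mainTheorem2 :
    -- the construction is a bijection between suitably labeled maps and mobiles
    (∃ F : LabeledMap.IsoClass LabeledMap.IsSuitablyLabeled ≃
        LabeledMap.IsoClass LabeledMap.IsMobile,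
      ∀ (M : LabeledMap ℤ) (hM : M.IsSuitablyLabeled), ∃ hB : M.mobileOf.IsMobile,
        F (LabeledMap.isoClass _ M hM) = LabeledMap.isoClass _ M.mobileOf hB) ∧
    -- the correspondences between the components
    (∀ M : LabeledMap ℤ, M.IsSuitablyLabeled →
      ∃ (minFace : {v : M.Vertex // M.IsLocalMin v} ≃ M.mobileOf.Face)
        (nonMinVertex : {v : M.Vertex // ¬ M.IsLocalMin v} ≃
          {w : M.mobileOf.Vertex // M.mobileOf.label w ≠ none})
        (faceVertex : M.Face ≃ {w : M.mobileOf.Vertex // M.mobileOf.label w = none})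
        (edgeCorner : M.Edge ≃
          {c : M.mobileOf.Corner // M.mobileOf.label (M.mobileOf.origin c) ≠ none}),
        (∀ v, M.mobileOf.label (nonMinVertex v).1 = some (M.label v.1)) ∧
        (∀ f, M.faceDegree f = 2 * M.mobileOf.vertexDegree (faceVertex f).1) ∧
        (∀ (d : M.Dart) (l : ℤ),
          M.label (M.origin d) = l → M.label (M.origin (M.rev d)) = l - 1 →
          M.mobileOf.label (M.mobileOf.origin (edgeCorner (M.edge d)).1) = some l) ∧
        -- they are the ones given by the construction
        (∀ v d, M.IsDown d → M.origin (M.rev d) = v.1 →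
          minFace v = M.mobileOf.leftFace (M.toMobile d)) ∧
        (∀ v d, M.IsDown d → M.origin d = v.1 →
          (nonMinVertex v).1 = M.mobileOf.origin (M.toMobile d)) ∧
        (∀ d, M.IsUp d →
          (faceVertex (M.leftFace d)).1 = M.mobileOf.origin (M.toMobile d)) ∧
        (∀ d, M.IsDown d → (edgeCorner (M.edge d)).1 = M.toMobile d)) ∧
    -- quadrangulations correspond to well-labeled maps (to well-labeled trees if there is a
    -- unique local min)
    (∃ G : LabeledMap.IsoClass
          (fun M : LabeledMap ℤ => M.IsSuitablyLabeled ∧ M.IsQuadrangulation) ≃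
        LabeledMap.IsoClass LabeledMap.IsWellLabeled,
      ∀ (M : LabeledMap ℤ) (hM : M.IsSuitablyLabeled ∧ M.IsQuadrangulation)
        (W : LabeledMap ℤ) (hW : W.IsWellLabeled),
        (G (LabeledMap.isoClass _ M hM) = LabeledMap.isoClass _ W hW ↔
          M.mobileOf.Iso W.subdivide) ∧
        (M.mobileOf.Iso W.subdivide →
          ((∃! v, M.IsLocalMin v) ↔ Nat.card W.Face = 1))) ∧
    -- a unique local min means a geodesic labeling, and a mobile that is a tree
    (∀ M : LabeledMap ℤ, M.IsSuitablyLabeled →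
      ((∃! v, M.IsLocalMin v) ↔ Nat.card M.mobileOf.Face = 1) ∧
      ∀ m : M.Vertex, (∀ v, M.IsLocalMin v ↔ v = m) ↔
        ∀ v, M.label v = M.label m + (M.graph.dist m v : ℤ)) ∧
    -- every pointed bipartite planar map carries a geodesic labeling
    (∀ C : CombMap, C.IsPlanar → C.IsBipartite →
      ∀ m : C.Vertex, (LabeledMap.geodesic C m).IsSuitablyLabeled) := by
  refine ⟨LabeledMap.exists_mobile_equiv, fun M h => ?_,
    LabeledMap.exists_quadrangulation_equiv,
    fun M h => ⟨LabeledMap.HasUnitSteps.existsUnique_isLocalMin_iff h.2, h.unique_isLocalMin_iff⟩,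
    fun C hC hb m => LabeledMap.isSuitablyLabeled_geodesic hC hb m⟩
  have hM : M.HasUnitSteps := h.2
  obtain ⟨minFace, hmin⟩ := hM.exists_minFace
  obtain ⟨nonMinVertex, hnonMin⟩ := hM.exists_nonMinVertex
  obtain ⟨faceVertex, hface, hdegree⟩ := hM.exists_faceVertex
  obtain ⟨edgeCorner, hedge⟩ := hM.exists_edgeCorner
  refine ⟨minFace, nonMinVertex, faceVertex, edgeCorner, ?_, hdegree, ?_, hmin, hnonMin,
    fun d hd => hface d ((hM.isUp_iff d).1 hd), hedge⟩
  · intro v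
    obtain ⟨d, hd, hv⟩ := (hM.not_isLocalMin_iff _).1 v.2
    rw [hnonMin v d hd hv, ← hv]
    exact LabeledMap.label_mobileOf_of_isDown hd
  · intro d l hl hl'
    have hd : M.IsDown d := by
      rw [LabeledMap.IsDown, hl, hl']
      omega
    rw [hedge d hd, ← hl]
    exact LabeledMap.label_mobileOf_of_isDown hd
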